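/- Let $d\ge 1$ and let $\Omega\subset\mathbb R^d$ be a bounded domain (nonempty, open, connected). For $\tau\in\mathbb R$ let $\Gamma_1\le\Gamma_2\le\cdots$ denote the eigenvalues, counted with multiplicity, of the clamped plate problem with tension $\tau$ on $\Omega$: $$\Delta^2u-\tau\Delta u=\Gamma u\ \text{ on }\Omega,\qquad u=\frac{\partial u}{\partial n}=0\ \text{ on }\partial\Omega,$$ understood weakly: $0\ne u\in H^2_0(\Omega)$ (the closure of $C_c^\infty(\Omega)$ in $H^2(\mathbb R^d)$) and $\int\Delta u\,\Delta v+\tau\int\nabla u\cdot\nabla v=\Gamma\int uv$ for all $v\in H^2_0(\Omega)$. Write $(\Gamma_1+\dots+\Gamma_n)\big|_{\tau,\Omega}$ for the sum of the first $n$ of them. For a linear map $A$ of $\mathbb R^d$ let $\|A\|_m^m$ denote the sum of the $m$-th powers of the singular values of $A$. Suppose that the isometry group of $\Omega$ (all isometries of $\mathbb R^d$ mapping $\Omega$ onto itself) is irreducible, i.e. no linear subspace of $\mathbb R^d$ other than $\{0\}$ and $\mathbb R^d$ is invariant under the orthogonal parts of all its elements. Let $T:\mathbb R^d\to\mathbb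 R^d$ be an invertible linear transformation, $\tau\in\mathbb R$, $n\ge 0$. Put $$C(T^{-1})=\|T^{-1}\|_4^4,\qquad D(T^{-1})=\frac{\|T^{-1}\|_2^4+2\|T^{-1}\|_4^4}{d+2}.$$ 1. $$(\Gamma_1+\dots+\Gamma_n)\Big|_{\tau C(T^{-1})/\|T^{-1}\|_2^2,\;T(\Omega)}\le\frac{C(T^{-1})}{d}\,(\Gamma_1+\dots+\Gamma_n)\Big|_{\tau,\Omega}.$$ 2. If moreover $\Omega$ admits $2$-frames, i.e. every homogeneous polynomial of degree $4$ on $\mathbb R^d$ that is invariant under the orthogonal parts of all isometries of $\Omega$ is a constant multiple of $|x|^4$, then $$(\Gamma_1+\dots+\Gamma_n)\Big|_{\tau D(T^{-1})/\|T^{-1}\|_2^2,\;T(\Omega)}\le\frac{D(T^{-1})}{d}\,(\Gamma_1+\dots+\Gamma_n)\Big|_{\tau,\Omega}.$$ 3. $D(T^{-1})\le C(T^{-1})$. 4. If $T$ is a scalar multiple of an orthogonal transformation, then equality holds in the inequalities of 1 and 2. -/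

import Mathlib

open MeasureTheory
open scoped ContDiff

noncomputable section

/-! ### Symmetries of a domain -/

/-- The isometry group of `Ω ⊆ ℝ^d`: all isometries of `ℝ^d` (they are affine, and need not fix the
origin) that map `Ω` onto itself. -/
def isometryGroup {d : ℕ} (Ω : Set (EuclideanSpace ℝ (Fin d))) :
    Subgroup (EuclideanSpace ℝ (Fin d) ≃ᵃⁱ[ℝ] EuclideanSpace ℝ (Fin d)) where
  carrier := {g | g '' Ω = Ω}
  one_mem' := by simp
  mul_mem' := by
    intro a b ha hb
    simp only [Set.mem_ofPred_eq, AffineIsometryEquiv.coe_mul, Set.image_comp] at *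
    rw [hb, ha]
  inv_mem' := by
    intro a ha
    have h : (a⁻¹ : EuclideanSpace ℝ (Fin d) ≃ᵃⁱ[ℝ] EuclideanSpace ℝ (Fin d)) '' (a '' Ω) = Ω := by
      rw [← Set.image_comp, ← AffineIsometryEquiv.coe_mul]
      simp
    simp only [Set.mem_ofPred_eq] at *
    rwa [ha] at h

/-- The representation of the isometry group of `Ω` on `ℝ^d` by the linear (orthogonal) parts of its
elements. -/
def isometryRep {d : ℕ} (Ω : Set (EuclideanSpace ℝ (Fin d))) :
    Representation ℝ (isometryGroup Ω) (EuclideanSpace ℝ (Fin d)) where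
  toFun g := (g.1.linearIsometryEquiv.toLinearEquiv : EuclideanSpace ℝ (Fin d) →ₗ[ℝ] _)
  map_one' := rfl
  map_mul' _ _ := rfl

/-- The domain `Ω` admits `p`-frames: its isometry group has a unique invariant polynomial of degree
`2p`, i.e. every homogeneous polynomial of degree `2p` that is invariant under the orthogonal parts of
all isometries of `Ω` is a constant multiple of `|x|^(2p)`. -/
def AdmitsFrames {d : ℕ} (p : ℕ) (Ω : Set (EuclideanSpace ℝ (Fin d))) : Prop :=
  ∀ P : MvPolynomial (Fin d) ℝ, P.IsHomogeneous (2 * p) →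
    (∀ g : isometryGroup Ω, ∀ x : EuclideanSpace ℝ (Fin d),
      MvPolynomial.eval (fun i => isometryRep Ω g x i) P = MvPolynomial.eval (fun i => x i) P) →
    ∃ c : ℝ, P = MvPolynomial.C c * (∑ i, MvPolynomial.X i ^ 2) ^ p

/-! ### Schatten norms -/

/-- The `n`-th power `‖A‖_n^n` of the Schatten norm of order `n`: the sum of the `n`-th powers of the
singular values of `A`. -/
def schattenPow {d : ℕ} (n : ℕ) (A : EuclideanSpace ℝ (Fin d) →ₗ[ℝ] EuclideanSpace ℝ (Fin d)) : ℝ :=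
  ∑ i ∈ Finset.range d, A.singularValues i ^ n

/-- `C(A) = ‖A‖_4^4`. -/
def constC {d : ℕ} (A : EuclideanSpace ℝ (Fin d) →ₗ[ℝ] EuclideanSpace ℝ (Fin d)) : ℝ :=
  schattenPow 4 A

/-- `D(A) = (‖A‖_2^4 + 2 ‖A‖_4^4) / (d + 2)`. -/
def constD {d : ℕ} (A : EuclideanSpace ℝ (Fin d) →ₗ[ℝ] EuclideanSpace ℝ (Fin d)) : ℝ :=
  (schattenPow 2 A ^ 2 + 2 * schattenPow 4 A) / (d + 2)

/-! ### The Sobolev space `H^2_0(Ω)` -/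

/-- Real-valued `L^2(ℝ^d)`. -/
abbrev L2 (d : ℕ) : Type := Lp ℝ 2 (volume : Measure (EuclideanSpace ℝ (Fin d)))

/-- Triples `(u, (∂ᵢu)ᵢ, (∂ᵢ∂ⱼu)ᵢⱼ)` of `L^2` data. The product topology is that of the norm
`‖u‖² + ∑ ‖∂ᵢu‖² + ∑ ‖∂ᵢ∂ⱼu‖²` of `H^2(ℝ^d)`. -/
abbrev Jet (d : ℕ) : Type := L2 d × (Fin d → L2 d) × (Fin d → Fin d → L2 d)

/-- The `i`-th partial derivative of a function on `ℝ^d`. -/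
def partialDeriv {d : ℕ} (i : Fin d) (φ : EuclideanSpace ℝ (Fin d) → ℝ) :
    EuclideanSpace ℝ (Fin d) → ℝ :=
  fun x => fderiv ℝ φ x (EuclideanSpace.single i 1)

/-- `φ ∈ C_c^∞(Ω)`. -/
def IsTest {d : ℕ} (Ω : Set (EuclideanSpace ℝ (Fin d))) (φ : EuclideanSpace ℝ (Fin d) → ℝ) : Prop :=
  ContDiff ℝ ∞ φ ∧ HasCompactSupport φ ∧ tsupport φ ⊆ Ω

/-- `U` is the triple of a function `φ` with its classical first and second derivatives. -/
def IsJetOf {d : ℕ} (U : Jet d) (φ : EuclideanSpace ℝ (Fin d) → ℝ) : Prop :=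
  U.1 =ᵐ[volume] φ ∧ (∀ i, U.2.1 i =ᵐ[volume] partialDeriv i φ) ∧
    ∀ i j, U.2.2 i j =ᵐ[volume] partialDeriv i (partialDeriv j φ)

theorem contDiff_partialDeriv {d : ℕ} (i : Fin d) {φ : EuclideanSpace ℝ (Fin d) → ℝ}
    (h : ContDiff ℝ ∞ φ) : ContDiff ℝ ∞ (partialDeriv i φ) :=
  (h.fderiv_right (m := ∞) (by simp)).clm_apply contDiff_const

theorem partialDeriv_add {d : ℕ} (i : Fin d) {φ ψ : EuclideanSpace ℝ (Fin d) → ℝ}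
    (hφ : ContDiff ℝ ∞ φ) (hψ : ContDiff ℝ ∞ ψ) :
    partialDeriv i (φ + ψ) = partialDeriv i φ + partialDeriv i ψ := by
  funext x
  simp only [partialDeriv, Pi.add_apply]
  rw [fderiv_add (hφ.differentiable (by simp) x) (hψ.differentiable (by simp) x)]
  rfl

theorem partialDeriv_smul {d : ℕ} (i : Fin d) (c : ℝ) {φ : EuclideanSpace ℝ (Fin d) → ℝ}
    (hφ : ContDiff ℝ ∞ φ) : partialDeriv i (c • φ) = c • partialDeriv i φ := by
  funext x
  simp only [partialDeriv, Pi.smul_apply]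
  rw [fderiv_const_smul (hφ.differentiable (by simp) x)]
  rfl

/-- The linear space of all triples `(φ, ∂φ, ∂²φ)` with `φ ∈ C_c^∞(Ω)`. -/
def testJets {d : ℕ} (Ω : Set (EuclideanSpace ℝ (Fin d))) : Submodule ℝ (Jet d) where
  carrier := {U | ∃ φ, IsTest Ω φ ∧ IsJetOf U φ}
  zero_mem' := by
    refine ⟨0, ⟨contDiff_const, HasCompactSupport.zero, by simp [tsupport]⟩, ?_⟩
    have h0 : ∀ i : Fin d, partialDeriv i (0 : EuclideanSpace ℝ (Fin d) → ℝ) = 0 := by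
      intro i
      funext x
      simp [partialDeriv]
    refine ⟨Lp.coeFn_zero _ _ _, fun i => ?_, fun i j => ?_⟩
    · rw [h0]
      exact Lp.coeFn_zero _ _ _
    · rw [h0, h0]
      exact Lp.coeFn_zero _ _ _
  add_mem' := by
    rintro U V ⟨φ, ⟨hφ, hφc, hφs⟩, h1, h2, h3⟩ ⟨ψ, ⟨hψ, hψc, hψs⟩, k1, k2, k3⟩
    refine ⟨φ + ψ, ⟨hφ.add hψ, hφc.add hψc,
      (tsupport_add φ ψ).trans (Set.union_subset hφs hψs)⟩, ?_, fun i => ?_, fun i j => ?_⟩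
    · exact (Lp.coeFn_add _ _).trans (h1.add k1)
    · rw [partialDeriv_add i hφ hψ]
      exact (Lp.coeFn_add _ _).trans ((h2 i).add (k2 i))
    · rw [partialDeriv_add j hφ hψ,
        partialDeriv_add i (contDiff_partialDeriv j hφ) (contDiff_partialDeriv j hψ)]
      exact (Lp.coeFn_add _ _).trans ((h3 i j).add (k3 i j))
  smul_mem' := by
    rintro c U ⟨φ, ⟨hφ, hφc, hφs⟩, h1, h2, h3⟩
    refine ⟨c • φ, ⟨hφ.const_smul c, hφc.smul_left (f := fun _ => c),
      (tsupport_smul_subset_right (fun _ => c) φ).trans hφs⟩, ?_, fun i => ?_, fun i j => ?_⟩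
    · exact (Lp.coeFn_smul _ _).trans (h1.const_smul c)
    · rw [partialDeriv_smul i c hφ]
      exact (Lp.coeFn_smul _ _).trans ((h2 i).const_smul c)
    · rw [partialDeriv_smul j c hφ, partialDeriv_smul i c (contDiff_partialDeriv j hφ)]
      exact (Lp.coeFn_smul _ _).trans ((h3 i j).const_smul c)

/-- `H^2_0(Ω)`, the closure of `C_c^∞(Ω)` in the norm of `H^2(ℝ^d)`. Each element is recorded together
with its weak first and second derivatives. -/
def H20 {d : ℕ} (Ω : Set (EuclideanSpace ℝ (Fin d))) : Submodule ℝ (Jet d) :=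
  (testJets Ω).topologicalClosure

/-! ### Eigenvalues of the clamped plate -/

/-- The quadratic form of `Δ² - τΔ` on `H^2_0`, i.e. `∫ Δu Δv + τ ∫ ∇u · ∇v`. -/
def plateForm {d : ℕ} (τ : ℝ) (U V : Jet d) : ℝ :=
  inner ℝ (∑ i, U.2.2 i i) (∑ i, V.2.2 i i) + τ * ∑ i, inner ℝ (U.2.1 i) (V.2.1 i)

/-- `U` is an eigenfunction, with eigenvalue `Γ`, of the clamped plate problem with tension `τ`:
`Δ²u - τΔu = Γu` weakly on `Ω`, with `u ∈ H^2_0(Ω)` and `u ≠ 0`. -/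
def IsPlateEigenfunction {d : ℕ} (Ω : Set (EuclideanSpace ℝ (Fin d))) (τ Γ : ℝ) (U : Jet d) : Prop :=
  U ∈ H20 Ω ∧ U.1 ≠ 0 ∧ ∀ V ∈ H20 Ω, plateForm τ U V = Γ * inner ℝ U.1 V.1

/-- The `k`-th eigenvalue `Γ_k`, for `k = 1, 2, …`, in nondecreasing order and counted with
multiplicity: the least `t` such that there are `k` linearly independent eigenfunctions whose
eigenvalues are at most `t`. -/
def plateEigenvalue {d : ℕ} (Ω : Set (EuclideanSpace ℝ (Fin d))) (τ : ℝ) (k : ℕ) : ℝ :=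
  sInf {t : ℝ | ∃ U : Fin k → Jet d, LinearIndependent ℝ (fun i => (U i).1) ∧
    ∀ i, ∃ Γ ≤ t, IsPlateEigenfunction Ω τ Γ (U i)}

/-- `Γ_1 + ⋯ + Γ_n`, evaluated on the domain `Ω` with tension `τ`. -/
def plateSum {d : ℕ} (Ω : Set (EuclideanSpace ℝ (Fin d))) (τ : ℝ) (n : ℕ) : ℝ :=
  ∑ k ∈ Finset.Icc 1 n, plateEigenvalue Ω τ k

end

noncomputable section

/-! ### Semibounded symmetric forms with compact embedding -/

section SpectralTheory

variable {E L : Type*} [NormedAddCommGroup E] [NormedSpace ℝ E] [NormedAddCommGroup L]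
  [InnerProductSpace ℝ L]

/-- A symmetric bilinear form `a` on `E`, coercive up to a multiple of the squared norm of the
compact map `ι : E → L`, whose range is infinite-dimensional. -/
structure IsCompactForm (a : LinearMap.BilinForm ℝ E) (ι : E →L[ℝ] L) : Prop where
  symm : ∀ x y, a x y = a y x
  cont : Continuous fun x => a x x
  coercive : ∃ K l : ℝ, 0 < K ∧ ∀ x, ‖x‖ ^ 2 ≤ K * (a x x + l * ‖ι x‖ ^ 2)
  compact : ∀ (x : ℕ → E) (R : ℝ), (∀ n, ‖x n‖ ≤ R) →
    ∃ φ : ℕ → ℕ, StrictMono φ ∧ CauchySeq fun n => ι (x (φ n))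
  infinite : ∀ (n : ℕ) (f : ℕ → L), ∃ x, ι x ≠ 0 ∧ ∀ i < n, inner ℝ (f i) (ι x) = 0

variable {a : LinearMap.BilinForm ℝ E} {ι : E →L[ℝ] L}

theorem eq_zero_of_forall_quadratic_nonneg {p q : ℝ} (h : ∀ s : ℝ, 0 ≤ 2 * s * p + s ^ 2 * q) :
    p = 0 := by
  have := discrim_le_zero (a := q) (b := 2 * p) (c := 0) (fun s => by linarith [h s])
  simp only [discrim] at this
  nlinarith [sq_nonneg p]

/-- A minimiser of the Rayleigh quotient on a subspace satisfies the weak eigenvalue equation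
there. -/
theorem form_eq_of_forall_le (hs : ∀ x y, a x y = a y x) {W : Submodule ℝ E} {x : E} (hx : x ∈ W)
    (hx1 : ‖ι x‖ = 1) (hmin : ∀ y ∈ W, a x x * ‖ι y‖ ^ 2 ≤ a y y) {y : E} (hy : y ∈ W) :
    a x y = a x x * inner ℝ (ι x) (ι y) := by
  have h0 : a x y - a x x * inner ℝ (ι x) (ι y) = 0 := by
    apply eq_zero_of_forall_quadratic_nonneg (q := a y y - a x x * ‖ι y‖ ^ 2)
    intro s
    have h := hmin _ (W.add_mem hx (W.smul_mem s hy))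
    rw [map_add, map_smul, norm_add_sq_real, norm_smul, inner_smul_right, hx1, mul_pow,
      Real.norm_eq_abs, sq_abs] at h
    simp only [map_add, map_smul, LinearMap.add_apply, LinearMap.smul_apply, smul_eq_mul] at h
    rw [hs y x] at h
    nlinarith [h]
  linarith

/-- Existence of minimisers of the Rayleigh quotient under finitely many orthogonality
constraints. -/
theorem IsCompactForm.exists_minimizer [CompleteSpace E] (h : IsCompactForm a ι) (n : ℕ)
    (f : ℕ → L) :
    ∃ x, (∀ i < n, inner ℝ (f i) (ι x) = 0) ∧ ‖ι x‖ = 1 ∧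
      ∀ y, (∀ i < n, inner ℝ (f i) (ι y) = 0) → a x x * ‖ι y‖ ^ 2 ≤ a y y := by
  obtain ⟨K, l, hK, hco⟩ := h.coercive
  set S : Set ℝ := {t | ∃ x, (∀ i < n, inner ℝ (f i) (ι x) = 0) ∧ ‖ι x‖ = 1 ∧ a x x = t} with hS
  have hnorm : ∀ x, (∀ i < n, inner ℝ (f i) (ι x) = 0) → ι x ≠ 0 →
      a x x / ‖ι x‖ ^ 2 ∈ S := by
    intro x hx hx0
    have hx0' : ‖ι x‖ ≠ 0 := norm_ne_zero_iff.2 hx0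
    refine ⟨‖ι x‖⁻¹ • x, fun i hi => ?_, ?_, ?_⟩
    · rw [map_smul, inner_smul_right, hx i hi, mul_zero]
    · rw [map_smul, norm_smul, norm_inv, norm_norm, inv_mul_cancel₀ hx0']
    · simp only [map_smul, LinearMap.smul_apply, smul_eq_mul]
      field_simp
  have hSne : S.Nonempty := by
    obtain ⟨x, hx0, hx⟩ := h.infinite n f
    exact ⟨_, hnorm x hx hx0⟩
  have hSbdd : BddBelow S := by
    refine ⟨-l, ?_⟩
    rintro t ⟨x, -, hx1, rfl⟩
    have h1 := hco x
    rw [hx1] at h1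
    have h2 : 0 ≤ K * (a x x + l * 1 ^ 2) := (sq_nonneg _).trans h1
    have := nonneg_of_mul_nonneg_right h2 hK
    linarith
  set m := sInf S with hm
  have hmle : ∀ y, (∀ i < n, inner ℝ (f i) (ι y) = 0) → m * ‖ι y‖ ^ 2 ≤ a y y := by
    intro y hy
    by_cases hy0 : ι y = 0
    · have h1 := hco y
      rw [hy0] at h1 ⊢
      have h2 : 0 ≤ K * (a y y) := by
        have := (sq_nonneg ‖y‖).trans h1
        simpa using this
      have := nonneg_of_mul_nonneg_right h2 hK
      simpa using this
    · have h1 := csInf_le hSbdd (hnorm y hy hy0)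
      rwa [le_div_iff₀ (by positivity)] at h1
  have hseq : ∀ k : ℕ, ∃ x, (∀ i < n, inner ℝ (f i) (ι x) = 0) ∧ ‖ι x‖ = 1 ∧
      a x x < m + 1 / ((k : ℝ) + 1) := by
    intro k
    obtain ⟨t, ⟨x, h1, h2, rfl⟩, h3⟩ := exists_lt_of_csInf_lt hSne
      (show sInf S < m + 1 / ((k : ℝ) + 1) from lt_add_of_pos_right _ Nat.one_div_pos_of_nat)
    exact ⟨x, h1, h2, h3⟩
  choose x hxo hx1 hxa using hseq
  have hbd : ∀ k, ‖x k‖ ≤ Real.sqrt (K * (m + 1 + l)) := by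
    intro k
    apply Real.le_sqrt_of_sq_le
    refine (hco _).trans ?_
    rw [hx1]
    have : (1 : ℝ) / (k + 1) ≤ 1 := by
      rw [div_le_one (by positivity)]
      linarith [(Nat.cast_nonneg k : (0 : ℝ) ≤ k)]
    gcongr
    · linarith [hxa k]
    · simp
  obtain ⟨φ, hφ, hcau⟩ := h.compact x _ hbd
  have hkey : ∀ i j, ‖x i - x j‖ ^ 2 ≤ K * (2 * (1 / ((i : ℝ) + 1)) + 2 * (1 / ((j : ℝ) + 1)) +
      |m + l| * ‖ι (x i) - ι (x j)‖ ^ 2) := by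
    intro i j
    have h1 := hmle (x i + x j) (fun k hk => by
      rw [map_add, inner_add_right, hxo i k hk, hxo j k hk, add_zero])
    have h2 := hco (x i - x j)
    have hpar := parallelogram_law_with_norm ℝ (ι (x i)) (ι (x j))
    rw [hx1, hx1] at hpar
    have h3 : a (x i - x j) (x i - x j) = 2 * a (x i) (x i) + 2 * a (x j) (x j) -
        a (x i + x j) (x i + x j) := by
      simp only [map_add, map_sub, LinearMap.add_apply, LinearMap.sub_apply]
      ring
    rw [map_add] at h1
    rw [h3, map_sub] at h2
    refine h2.trans (mul_le_mul_of_nonneg_left ?_ hK.le)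
    have h4 : ‖ι (x i) + ι (x j)‖ ^ 2 = 4 - ‖ι (x i) - ι (x j)‖ ^ 2 := by nlinarith
    rw [h4] at h1
    have h5 : (m + l) * ‖ι (x i) - ι (x j)‖ ^ 2 ≤ |m + l| * ‖ι (x i) - ι (x j)‖ ^ 2 := by
      gcongr
      exact le_abs_self _
    nlinarith [hxa i, hxa j]
  have hcx : CauchySeq fun k => x (φ k) := by
    rw [Metric.cauchySeq_iff'] at hcau ⊢
    intro ε hε
    set δ := ε ^ 2 / (K * 8) with hδ
    have hδ0 : 0 < δ := by positivity
    set η := Real.sqrt (ε ^ 2 / (4 * K * (|m + l| + 1))) with hη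
    have hη0 : 0 < η := Real.sqrt_pos.2 (by positivity)
    rw [← Metric.cauchySeq_iff'] at hcau
    obtain ⟨N, hN⟩ := Metric.cauchySeq_iff.1 hcau η hη0
    obtain ⟨N', hN'⟩ := exists_nat_one_div_lt hδ0
    refine ⟨max N N', fun k hk => ?_⟩
    have e1 : ∀ k, N' ≤ k → 1 / ((φ k : ℝ) + 1) ≤ δ := by
      intro k hk
      refine le_trans ?_ hN'.le
      have : (N' : ℝ) ≤ φ k := by exact_mod_cast hk.trans (hφ.id_le k)
      gcongr
    have e2 := hN k ((le_max_left _ _).trans hk) _ (le_max_left N N')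
    rw [dist_eq_norm] at e2 ⊢
    have e3 : ‖ι (x (φ k)) - ι (x (φ (max N N')))‖ ^ 2 < ε ^ 2 / (4 * K * (|m + l| + 1)) := by
      rw [← Real.sq_sqrt (show 0 ≤ ε ^ 2 / (4 * K * (|m + l| + 1)) by positivity)]
      gcongr
    apply lt_of_pow_lt_pow_left₀ 2 hε.le
    refine (hkey _ _).trans_lt ?_
    have e4 : |m + l| * ‖ι (x (φ k)) - ι (x (φ (max N N')))‖ ^ 2 ≤ ε ^ 2 / (4 * K) := by
      calc _ ≤ (|m + l| + 1) * (ε ^ 2 / (4 * K * (|m + l| + 1))) := by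
            gcongr
            linarith
        _ = ε ^ 2 / (4 * K) := by field_simp
    calc _ ≤ K * (2 * δ + 2 * δ + ε ^ 2 / (4 * K)) := by
          gcongr
          · exact e1 _ ((le_max_right _ _).trans hk)
          · exact e1 _ (le_max_right _ _)
      _ = ε ^ 2 * (3 / 4) := by rw [hδ]; field_simp; ring
      _ < ε ^ 2 := by nlinarith [pow_pos hε 2]
  obtain ⟨z, hz⟩ := cauchySeq_tendsto_of_complete hcx
  have hιz : Filter.Tendsto (fun k => ι (x (φ k))) Filter.atTop (nhds (ι z)) :=
    (ι.continuous.tendsto z).comp hz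
  have hz1 : ‖ι z‖ = 1 :=
    tendsto_nhds_unique hιz.norm (by simp only [hx1]; exact tendsto_const_nhds)
  have hzo : ∀ i < n, inner ℝ (f i) (ι z) = 0 := by
    intro i hi
    refine tendsto_nhds_unique (Filter.Tendsto.inner tendsto_const_nhds hιz) ?_
    simp only [hxo _ i hi]
    exact tendsto_const_nhds
  have haz : a z z ≤ m := by
    have h1 : Filter.Tendsto (fun k => a (x (φ k)) (x (φ k))) Filter.atTop (nhds (a z z)) :=
      (h.cont.tendsto z).comp hz
    have h2 : Filter.Tendsto (fun k => m + 1 / ((φ k : ℝ) + 1)) Filter.atTop (nhds (m + 0)) :=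
      tendsto_const_nhds.add (tendsto_one_div_add_atTop_nhds_zero_nat.comp hφ.tendsto_atTop)
    rw [add_zero] at h2
    exact le_of_tendsto_of_tendsto' h1 h2 fun k => (hxa _).le
  refine ⟨z, hzo, hz1, fun y hy => le_trans ?_ (hmle y hy)⟩
  gcongr

/-- Existence of the first `n` eigenvectors, with the variational characterisation of the
eigenvalues. -/
theorem IsCompactForm.exists_eigenvectors [CompleteSpace E] (h : IsCompactForm a ι) (n : ℕ) :
    ∃ (u : ℕ → E) (γ : ℕ → ℝ),
      (∀ i < n, ∀ j < n, inner ℝ (ι (u i)) (ι (u j)) = if i = j then (1 : ℝ) else 0) ∧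
      (∀ k < n, ∀ y, a (u k) y = γ k * inner ℝ (ι (u k)) (ι y)) ∧
      ∀ k < n, ∀ y, (∀ i < k, inner ℝ (ι (u i)) (ι y) = 0) → γ k * ‖ι y‖ ^ 2 ≤ a y y := by
  induction n with
  | zero => exact ⟨0, 0, by simp, by simp, by simp⟩
  | succ n ih =>
    obtain ⟨u, γ, h1, h2, h3⟩ := ih
    obtain ⟨x, hxo, hx1, hxm⟩ := h.exists_minimizer n (fun i => ι (u i))
    have hu : ∀ k < n, Function.update u n x k = u k := fun k hk =>
      Function.update_of_ne hk.ne _ _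
    have hg : ∀ k < n, Function.update γ n (a x x) k = γ k := fun k hk =>
      Function.update_of_ne hk.ne _ _
    refine ⟨Function.update u n x, Function.update γ n (a x x), ?_, ?_, ?_⟩
    · intro i hi j hj
      rcases Nat.lt_succ_iff_lt_or_eq.1 hi with hi | rfl <;>
        rcases Nat.lt_succ_iff_lt_or_eq.1 hj with hj | rfl
      · rw [hu i hi, hu j hj, h1 i hi j hj]
      · rw [hu i hi, Function.update_self, hxo i hi, if_neg hi.ne]
      · rw [hu j hj, Function.update_self, real_inner_comm, hxo j hj, if_neg hj.ne']
      · rw [Function.update_self, real_inner_self_eq_norm_sq, hx1, if_pos rfl, one_pow]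
    · intro k hk y
      rcases Nat.lt_succ_iff_lt_or_eq.1 hk with hk | rfl
      · rw [hu k hk, hg k hk, h2 k hk]
      · rw [Function.update_self, Function.update_self]
        let W : Submodule ℝ E :=
          { carrier := {y | ∀ i < k, inner ℝ (ι (u i)) (ι y) = 0}
            add_mem' := fun {p q} hp hq i hi => by
              rw [map_add, inner_add_right, hp i hi, hq i hi, add_zero]
            zero_mem' := fun i _ => by rw [map_zero, inner_zero_right]
            smul_mem' := fun c p hp i hi => by
              rw [map_smul, inner_smul_right, hp i hi, mul_zero] }
        have hax : ∀ i < k, a x (u i) = 0 := fun i hi => by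
          rw [h.symm, h2 i hi, hxo i hi, mul_zero]
        have hW : y - ∑ j ∈ Finset.range k, (inner ℝ (ι (u j)) (ι y) : ℝ) • u j ∈ W := by
          intro i hi
          rw [map_sub, map_sum, inner_sub_right, inner_sum,
            Finset.sum_eq_single_of_mem i (Finset.mem_range.2 hi)]
          · rw [map_smul, inner_smul_right, h1 i hi i hi, if_pos rfl, mul_one, sub_self]
          · intro j hj hji
            rw [map_smul, inner_smul_right, h1 i hi j (Finset.mem_range.1 hj), if_neg hji.symm,
              mul_zero]
        have key := form_eq_of_forall_le (a := a) (ι := ι) h.symm (W := W) hxo hx1 hxm hW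
        rw [map_sub, map_sub, inner_sub_right, map_sum, map_sum, inner_sum,
          Finset.sum_eq_zero, Finset.sum_eq_zero, sub_zero, sub_zero] at key
        · exact key
        · intro j hj
          rw [map_smul, inner_smul_right, real_inner_comm (ι (u j)) (ι x),
            hxo j (Finset.mem_range.1 hj), mul_zero]
        · intro j hj
          rw [map_smul, hax j (Finset.mem_range.1 hj), smul_zero]
    · intro k hk y hy
      rcases Nat.lt_succ_iff_lt_or_eq.1 hk with hk | rfl
      · rw [hg k hk]
        refine h3 k hk y fun i hi => ?_
        have := hy i hi
        rwa [hu i (hi.trans hk)] at this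
      · rw [Function.update_self]
        refine hxm y fun i hi => ?_
        have := hy i hi
        rwa [hu i hi] at this

end SpectralTheory

section SpectralTheory

variable {E L : Type*} [NormedAddCommGroup E] [NormedSpace ℝ E] [NormedAddCommGroup L]
  [InnerProductSpace ℝ L] {a : LinearMap.BilinForm ℝ E} {ι : E →L[ℝ] L}

/-- `u 0, …, u (n-1)` are orthonormal eigenvectors of `a` with the lowest eigenvalues
`γ 0, …, γ (n-1)`. -/
structure IsLowestEigenvectors (a : LinearMap.BilinForm ℝ E) (ι : E →L[ℝ] L) (n : ℕ)
    (u : ℕ → E) (γ : ℕ → ℝ) : Prop where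
  orthonormal : ∀ i < n, ∀ j < n, inner ℝ (ι (u i)) (ι (u j)) = if i = j then (1 : ℝ) else 0
  eigen : ∀ k < n, ∀ y, a (u k) y = γ k * inner ℝ (ι (u k)) (ι y)
  le_form : ∀ k < n, ∀ y, (∀ i < k, inner ℝ (ι (u i)) (ι y) = 0) → γ k * ‖ι y‖ ^ 2 ≤ a y y

namespace IsLowestEigenvectors

variable {n : ℕ} {u : ℕ → E} {γ : ℕ → ℝ}

theorem norm_eq (h : IsLowestEigenvectors a ι n u γ) {k : ℕ} (hk : k < n) : ‖ι (u k)‖ = 1 := by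
  have := h.orthonormal k hk k hk
  rw [if_pos rfl, real_inner_self_eq_norm_sq] at this
  exact (pow_eq_one_iff_of_nonneg (norm_nonneg _) two_ne_zero).1 this

theorem form_self (h : IsLowestEigenvectors a ι n u γ) {k : ℕ} (hk : k < n) :
    a (u k) (u k) = γ k := by
  rw [h.eigen k hk, h.orthonormal k hk k hk, if_pos rfl, mul_one]

theorem mono (h : IsLowestEigenvectors a ι n u γ) {j k : ℕ} (hjk : j ≤ k) (hk : k < n) :
    γ j ≤ γ k := by
  have hj := hjk.trans_lt hk
  have := h.le_form j hj (u k) fun i hi => by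
    rw [h.orthonormal i (hi.trans hj) k hk, if_neg (hi.trans_le hjk).ne]
  rwa [h.norm_eq hk, h.form_self hk, one_pow, mul_one] at this

/-- Lower bound for the form in terms of the components along the eigenvectors. -/
theorem le_form_self (hs : ∀ x y, a x y = a y x) {m : ℕ}
    (h : IsLowestEigenvectors a ι (m + 1) u γ) (v : E) :
    γ m * ‖ι v‖ ^ 2 + ∑ j ∈ Finset.range (m + 1), (γ j - γ m) * inner ℝ (ι v) (ι (u j)) ^ 2 ≤
      a v v := by
  set c : ℕ → ℝ := fun j => inner ℝ (ι v) (ι (u j)) with hc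
  set p : E := ∑ j ∈ Finset.range (m + 1), c j • u j with hp
  have hup : ∀ i < m + 1, inner ℝ (ι (u i)) (ι p) = c i := by
    intro i hi
    rw [hp, map_sum, inner_sum, Finset.sum_eq_single_of_mem i (Finset.mem_range.2 hi)]
    · rw [map_smul, inner_smul_right, h.orthonormal i hi i hi, if_pos rfl, mul_one]
    · intro j hj hji
      rw [map_smul, inner_smul_right, h.orthonormal i hi j (Finset.mem_range.1 hj),
        if_neg hji.symm, mul_zero]
  have huw : ∀ i < m + 1, inner ℝ (ι (u i)) (ι (v - p)) = 0 := by
    intro i hi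
    rw [map_sub, inner_sub_right, hup i hi, hc, real_inner_comm, sub_self]
  have hpx : ∀ x, inner ℝ (ι p) x = ∑ j ∈ Finset.range (m + 1), c j * inner ℝ (ι (u j)) x := by
    intro x
    simp only [hp, map_sum, sum_inner, map_smul, inner_smul_left, RCLike.conj_to_real]
  have hax : ∀ x, a p x = ∑ j ∈ Finset.range (m + 1), c j * (γ j * inner ℝ (ι (u j)) (ι x)) := by
    intro x
    simp only [hp, map_sum, LinearMap.sum_apply, map_smul, LinearMap.smul_apply, smul_eq_mul]
    refine Finset.sum_congr rfl fun j hj => ?_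
    rw [h.eigen j (Finset.mem_range.1 hj)]
  have hpw : inner ℝ (ι p) (ι (v - p)) = 0 := by
    rw [hpx]
    exact Finset.sum_eq_zero fun j hj => by rw [huw j (Finset.mem_range.1 hj), mul_zero]
  have haw : a p (v - p) = 0 := by
    rw [hax]
    exact Finset.sum_eq_zero fun j hj => by
      rw [huw j (Finset.mem_range.1 hj), mul_zero, mul_zero]
  have hpp : ‖ι p‖ ^ 2 = ∑ j ∈ Finset.range (m + 1), c j ^ 2 := by
    rw [← real_inner_self_eq_norm_sq, hpx]
    exact Finset.sum_congr rfl fun j hj => by rw [hup j (Finset.mem_range.1 hj), sq]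
  have happ : a p p = ∑ j ∈ Finset.range (m + 1), γ j * c j ^ 2 := by
    rw [hax]
    exact Finset.sum_congr rfl fun j hj => by rw [hup j (Finset.mem_range.1 hj)]; ring
  have hv : v = p + (v - p) := by abel
  have hnv : ‖ι v‖ ^ 2 = ‖ι p‖ ^ 2 + ‖ι (v - p)‖ ^ 2 := by
    conv_lhs => rw [hv, map_add, norm_add_sq_real, hpw]
    ring
  have hav : a v v = a p p + a (v - p) (v - p) := by
    conv_lhs => rw [hv, map_add, map_add, LinearMap.add_apply, LinearMap.add_apply, haw,
      hs (v - p) p, haw]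
    ring
  have hw := h.le_form m (Nat.lt_succ_self m) (v - p) fun i hi => huw i (hi.trans (Nat.lt_succ_self m))
  rw [hnv, hav, hpp, happ]
  simp only [sub_mul, Finset.sum_sub_distrib, ← Finset.mul_sum]
  linarith

/-- **Ky Fan's inequality**: the sum of the lowest eigenvalues is at most the trace of the form on
any orthonormal family. -/
theorem sum_le (hs : ∀ x y, a x y = a y x) (h : IsLowestEigenvectors a ι n u γ) {v : Fin n → E}
    (hv : Orthonormal ℝ fun i => ι (v i)) :
    ∑ k ∈ Finset.range n, γ k ≤ ∑ i, a (v i) (v i) := by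
  rcases n with _ | m
  · simp
  have h1 : ∀ i, γ m + ∑ j ∈ Finset.range (m + 1), (γ j - γ m) * inner ℝ (ι (v i)) (ι (u j)) ^ 2 ≤
      a (v i) (v i) := by
    intro i
    have := h.le_form_self hs (v i)
    rwa [hv.1 i, one_pow, mul_one] at this
  refine le_trans ?_ (Finset.sum_le_sum fun i _ => h1 i)
  rw [Finset.sum_add_distrib, Finset.sum_comm, Finset.sum_const, Finset.card_univ, Fintype.card_fin]
  have h2 : ∀ j ∈ Finset.range (m + 1), γ j - γ m ≤
      ∑ i, (γ j - γ m) * inner ℝ (ι (v i)) (ι (u j)) ^ 2 := by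
    intro j hj
    have hj' := Finset.mem_range.1 hj
    have hb := hv.sum_inner_products_le (s := Finset.univ) (ι (u j))
    simp only [h.norm_eq hj', Real.norm_eq_abs, sq_abs, one_pow] at hb
    have hm := h.mono (Nat.lt_succ_iff.1 hj') (Nat.lt_succ_self m)
    rw [← Finset.mul_sum]
    nlinarith
  refine le_trans (le_of_eq ?_) (add_le_add_right (Finset.sum_le_sum h2) _)
  rw [Finset.sum_sub_distrib, Finset.sum_const, Finset.card_range]
  ring

/-- The counting definition of the eigenvalues agrees with the variational one. -/
theorem sInf_eq (hs : ∀ x y, a x y = a y x) (h : IsLowestEigenvectors a ι n u γ) {k : ℕ} (hk : k < n) :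
    sInf {t : ℝ | ∃ U : Fin (k + 1) → E, LinearIndependent ℝ (fun i => ι (U i)) ∧
      ∀ i, ∃ Γ ≤ t, ∀ y, a (U i) y = Γ * inner ℝ (ι (U i)) (ι y)} = γ k := by
  have hlt : ∀ i : Fin (k + 1), (i : ℕ) < n := fun i => (Nat.lt_succ_iff.1 i.2).trans_lt hk
  apply IsLeast.csInf_eq
  constructor
  · refine ⟨fun i => u i, Orthonormal.linearIndependent (𝕜 := ℝ) ?_, fun i =>
      ⟨γ i, h.mono (Nat.lt_succ_iff.1 i.2) hk, h.eigen i (hlt i)⟩⟩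
    rw [orthonormal_iff_ite]
    intro i j
    rw [h.orthonormal i (hlt i) j (hlt j)]
    simp [Fin.ext_iff]
  · rintro t ⟨U, hU, hE⟩
    choose Γ hΓ hE using hE
    let F : (Fin (k + 1) → ℝ) →ₗ[ℝ] (Fin k → ℝ) :=
      { toFun := fun c j => ∑ i, c i * inner ℝ (ι (u j)) (ι (U i))
        map_add' := fun c c' => by
          ext j
          simp [add_mul, Finset.sum_add_distrib]
        map_smul' := fun r c => by
          ext j
          simp [mul_assoc, Finset.mul_sum] }
    have hker : LinearMap.ker F ≠ ⊥ := LinearMap.ker_ne_bot_of_finrank_lt (by simp)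
    obtain ⟨c, hcF, hc0⟩ := Submodule.exists_mem_ne_zero_of_ne_bot hker
    set w : E := ∑ i, c i • U i with hw
    have hιw : ι w = ∑ i, c i • ι (U i) := by simp only [hw, map_sum, map_smul]
    have hw0 : ι w ≠ 0 := by
      intro h0
      apply hc0
      rw [hιw] at h0
      funext i
      exact Fintype.linearIndependent_iff.1 hU c h0 i
    have hwo : ∀ i < k, inner ℝ (ι (u i)) (ι w) = 0 := by
      intro i hi
      have := congrFun (LinearMap.mem_ker.1 hcF) ⟨i, hi⟩
      rw [hιw, inner_sum]
      simpa [F, inner_smul_right] using this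
    have h1 := h.le_form k hk w hwo
    have h2 : t * ‖ι w‖ ^ 2 - a w w = ‖∑ i, (c i * Real.sqrt (t - Γ i)) • ι (U i)‖ ^ 2 := by
      have e1 : a w w = ∑ i, ∑ j, c i * c j * (Γ i * inner ℝ (ι (U i)) (ι (U j))) := by
        simp only [hw, map_sum, LinearMap.sum_apply, map_smul, LinearMap.smul_apply, smul_eq_mul,
          Finset.mul_sum]
        rw [Finset.sum_comm]
        refine Finset.sum_congr rfl fun i _ => Finset.sum_congr rfl fun j _ => ?_
        rw [hE]
        ring
      have e2 : ∀ b : Fin (k + 1) → ℝ, ‖∑ i, b i • ι (U i)‖ ^ 2 =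
          ∑ i, ∑ j, b i * b j * inner ℝ (ι (U i)) (ι (U j)) := by
        intro b
        rw [← real_inner_self_eq_norm_sq, sum_inner]
        refine Finset.sum_congr rfl fun i _ => ?_
        rw [inner_sum]
        refine Finset.sum_congr rfl fun j _ => ?_
        rw [inner_smul_left, inner_smul_right, RCLike.conj_to_real]
        ring
      rw [e2, hιw, e2, e1, Finset.mul_sum, ← Finset.sum_sub_distrib]
      refine Finset.sum_congr rfl fun i _ => ?_
      rw [Finset.mul_sum, ← Finset.sum_sub_distrib]
      refine Finset.sum_congr rfl fun j _ => ?_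
      by_cases hij : Γ i = Γ j
      · have hsq := Real.mul_self_sqrt (sub_nonneg.2 (hΓ j))
        rw [hij]
        linear_combination (-c i * c j * inner ℝ (ι (U i)) (ι (U j))) * hsq
      · have h0 : inner ℝ (ι (U i)) (ι (U j)) = (0 : ℝ) := by
          have e3 := hE i (U j)
          have e4 := hE j (U i)
          rw [hs, e4, real_inner_comm] at e3
          by_contra hne
          exact hij (mul_right_cancel₀ hne e3).symm
        rw [h0]
        ring
    have h3 : γ k * ‖ι w‖ ^ 2 ≤ t * ‖ι w‖ ^ 2 := by
      have := sq_nonneg ‖∑ i, (c i * Real.sqrt (t - Γ i)) • ι (U i)‖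
      linarith
    exact le_of_mul_le_mul_right h3 (by positivity)

end IsLowestEigenvectors

theorem IsCompactForm.exists_isLowestEigenvectors [CompleteSpace E] (h : IsCompactForm a ι)
    (n : ℕ) : ∃ u γ, IsLowestEigenvectors a ι n u γ := by
  obtain ⟨u, γ, h1, h2, h3⟩ := h.exists_eigenvectors n
  exact ⟨u, γ, h1, h2, h3⟩

end SpectralTheory

/-! ### Integration by parts in `H^2_0` -/

section Jets

variable {d : ℕ} {Ω : Set (EuclideanSpace ℝ (Fin d))} {φ ψ : EuclideanSpace ℝ (Fin d) → ℝ}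

theorem IsTest.partialDeriv (h : IsTest Ω φ) (i : Fin d) : IsTest Ω (partialDeriv i φ) :=
  ⟨contDiff_partialDeriv i h.1, h.2.1.fderiv_apply ℝ _,
    (tsupport_fderiv_apply_subset ℝ _).trans h.2.2⟩

theorem IsTest.memLp (h : IsTest Ω φ) : MemLp φ 2 volume :=
  h.1.continuous.memLp_of_hasCompactSupport h.2.1

theorem IsTest.integrable_mul (h : IsTest Ω φ) (h' : IsTest Ω ψ) :
    Integrable fun x => φ x * ψ x :=
  (h.1.continuous.mul h'.1.continuous).integrable_of_hasCompactSupport h.2.1.mul_right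

theorem IsTest.integral_mul_partialDeriv (h : IsTest Ω φ) (h' : IsTest Ω ψ) (i : Fin d) :
    ∫ x, φ x * _root_.partialDeriv i ψ x = -∫ x, _root_.partialDeriv i φ x * ψ x :=
  integral_mul_fderiv_eq_neg_fderiv_mul_of_integrable
    ((h.partialDeriv i).integrable_mul h') (h.integrable_mul (h'.partialDeriv i))
    (h.integrable_mul h') (fun x _ => h.1.differentiable (by simp) x)
    (fun x _ => h'.1.differentiable (by simp) x)

theorem partialDeriv_comm (h : ContDiff ℝ ∞ φ) (i j : Fin d) :
    partialDeriv i (partialDeriv j φ) = partialDeriv j (partialDeriv i φ) := by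
  have key : ∀ (i j : Fin d) (x : EuclideanSpace ℝ (Fin d)), partialDeriv i (partialDeriv j φ) x =
      fderiv ℝ (fderiv ℝ φ) x (EuclideanSpace.single i 1) (EuclideanSpace.single j 1) := by
    intro i j x
    have hd : DifferentiableAt ℝ (fderiv ℝ φ) x :=
      (h.fderiv_right (m := ∞) (by simp)).differentiable (by simp) x
    unfold partialDeriv
    rw [fderiv_clm_apply hd (differentiableAt_const _)]
    simp
  funext x
  rw [key, key]
  exact (h.contDiffAt.isSymmSndFDerivAt
    (by simpa using (WithTop.coe_le_coe.2 (le_top : (2 : ℕ∞) ≤ ⊤)))) _ _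

theorem L2.inner_eq_integral {f g : L2 d} (hf : f =ᵐ[volume] φ) (hg : g =ᵐ[volume] ψ) :
    inner ℝ f g = ∫ x, φ x * ψ x := by
  rw [MeasureTheory.L2.inner_def]
  refine integral_congr_ae ?_
  filter_upwards [hf, hg] with x hx hy
  simp [hx, hy, mul_comm]

theorem H20.induction {p : Jet d → Prop} (hp : IsClosed {U | p U})
    (h : ∀ U φ, IsTest Ω φ → IsJetOf U φ → p U) {U : Jet d} (hU : U ∈ H20 Ω) : p U := by
  have hsub : (testJets Ω : Set (Jet d)) ⊆ {U | p U} := fun U ⟨φ, h1, h2⟩ => h U φ h1 h2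
  exact closure_minimal hsub hp hU

theorem H20.hess_symm {U : Jet d} (hU : U ∈ H20 Ω) (i j : Fin d) : U.2.2 i j = U.2.2 j i := by
  refine H20.induction (p := fun U => U.2.2 i j = U.2.2 j i)
    (isClosed_eq (by fun_prop) (by fun_prop)) (fun U φ hφ hUφ => ?_) hU
  apply Lp.ext
  refine (hUφ.2.2 i j).trans ?_
  rw [partialDeriv_comm hφ.1 i j]
  exact (hUφ.2.2 j i).symm

theorem H20.inner_hess_hess {U : Jet d} (hU : U ∈ H20 Ω) (i j k l : Fin d) :
    inner ℝ (U.2.2 i j) (U.2.2 k l) = inner ℝ (U.2.2 k j) (U.2.2 i l) := by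
  refine H20.induction (p := fun U => inner ℝ (U.2.2 i j) (U.2.2 k l) =
    inner ℝ (U.2.2 k j) (U.2.2 i l))
    (isClosed_eq (by fun_prop) (by fun_prop)) (fun U φ hφ hUφ => ?_) hU
  have key : ∀ i k : Fin d, inner ℝ (U.2.2 i j) (U.2.2 k l) =
      -∫ x, partialDeriv j φ x * partialDeriv i (partialDeriv k (partialDeriv l φ)) x := by
    intro i k
    rw [L2.inner_eq_integral (hUφ.2.2 i j) (hUφ.2.2 k l),
      (hφ.partialDeriv j).integral_mul_partialDeriv ((hφ.partialDeriv l).partialDeriv k), neg_neg]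
  rw [key, key, partialDeriv_comm (hφ.partialDeriv l).1 i k]

theorem H20.inner_grad_grad {U : Jet d} (hU : U ∈ H20 Ω) (i j : Fin d) :
    inner ℝ (U.2.1 i) (U.2.1 j) = -inner ℝ U.1 (U.2.2 i j) := by
  refine H20.induction (p := fun U => inner ℝ (U.2.1 i) (U.2.1 j) = -inner ℝ U.1 (U.2.2 i j))
    (isClosed_eq (by fun_prop) (by fun_prop)) (fun U φ hφ hUφ => ?_) hU
  rw [L2.inner_eq_integral (hUφ.2.1 i) (hUφ.2.1 j), L2.inner_eq_integral hUφ.1 (hUφ.2.2 i j),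
    hφ.integral_mul_partialDeriv (hφ.partialDeriv j), neg_neg]

theorem H20.norm_laplacian_sq {U : Jet d} (hU : U ∈ H20 Ω) :
    ‖∑ i, U.2.2 i i‖ ^ 2 = ∑ i, ∑ j, ‖U.2.2 i j‖ ^ 2 := by
  rw [← real_inner_self_eq_norm_sq, sum_inner]
  refine Finset.sum_congr rfl fun i _ => ?_
  rw [inner_sum]
  refine Finset.sum_congr rfl fun j _ => ?_
  rw [H20.inner_hess_hess hU, H20.hess_symm hU j i, real_inner_self_eq_norm_sq]

theorem H20.norm_grad_sq_le {U : Jet d} (hU : U ∈ H20 Ω) :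
    ∑ i, ‖U.2.1 i‖ ^ 2 ≤ ‖U.1‖ * ‖∑ i, U.2.2 i i‖ := by
  have : ∑ i, ‖U.2.1 i‖ ^ 2 = -inner ℝ U.1 (∑ i, U.2.2 i i) := by
    rw [inner_sum, ← Finset.sum_neg_distrib]
    refine Finset.sum_congr rfl fun i _ => ?_
    rw [← real_inner_self_eq_norm_sq, H20.inner_grad_grad hU]
  rw [this]
  exact (neg_le_abs _).trans (abs_real_inner_le_norm _ _)

/-- The plate form as a bilinear form on `H^2_0(Ω)`. -/
def plateBilin (Ω : Set (EuclideanSpace ℝ (Fin d))) (τ : ℝ) : LinearMap.BilinForm ℝ (H20 Ω) :=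
  LinearMap.mk₂ ℝ (fun U V => plateForm τ (U : Jet d) (V : Jet d))
    (fun U V W => by
      simp only [plateForm, Submodule.coe_add, Prod.snd_add, Prod.fst_add, Pi.add_apply,
        Finset.sum_add_distrib, inner_add_left]
      ring)
    (fun c U V => by
      simp only [plateForm, Submodule.coe_smul, Prod.smul_snd, Prod.smul_fst, Pi.smul_apply,
        ← Finset.smul_sum, inner_smul_left, RCLike.conj_to_real, ← Finset.mul_sum, smul_eq_mul]
      ring)
    (fun U V W => by
      simp only [plateForm, Submodule.coe_add, Prod.snd_add, Prod.fst_add, Pi.add_apply,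
        Finset.sum_add_distrib, inner_add_right]
      ring)
    (fun c U V => by
      simp only [plateForm, Submodule.coe_smul, Prod.smul_snd, Prod.smul_fst, Pi.smul_apply,
        ← Finset.smul_sum, inner_smul_right, ← Finset.mul_sum, smul_eq_mul]
      ring)

@[simp]
theorem plateBilin_apply (τ : ℝ) (U V : H20 Ω) :
    plateBilin Ω τ U V = plateForm τ (U : Jet d) (V : Jet d) := rfl

/-- The inclusion of `H^2_0(Ω)` into `L^2`. -/
def H20.toL2 (Ω : Set (EuclideanSpace ℝ (Fin d))) : H20 Ω →L[ℝ] L2 d :=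
  (ContinuousLinearMap.fst ℝ _ _).comp (H20 Ω).subtypeL

@[simp]
theorem H20.toL2_apply (U : H20 Ω) : H20.toL2 Ω U = (U : Jet d).1 := rfl

instance : CompleteSpace (H20 Ω) :=
  (Submodule.isClosed_topologicalClosure (testJets Ω)).completeSpace_coe

theorem plateForm_comm (τ : ℝ) (U V : Jet d) : plateForm τ U V = plateForm τ V U := by
  simp only [plateForm, real_inner_comm]

theorem continuous_plateForm_self (τ : ℝ) : Continuous fun U : Jet d => plateForm τ U U := by
  unfold plateForm
  fun_prop

theorem H20.norm_laplacian_sq_le (τ : ℝ) {U : Jet d} (hU : U ∈ H20 Ω) :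
    ‖∑ i, U.2.2 i i‖ ^ 2 ≤ 2 * plateForm τ U U + τ ^ 2 * ‖U.1‖ ^ 2 := by
  have h1 := H20.norm_grad_sq_le hU
  set D := ‖∑ i, U.2.2 i i‖
  set G := ∑ i, ‖U.2.1 i‖ ^ 2 with hG
  have hG0 : 0 ≤ G := by positivity
  have h2 : plateForm τ U U = D ^ 2 + τ * G := by
    simp only [plateForm, real_inner_self_eq_norm_sq, D, G]
  have h3 : -(τ * G) ≤ |τ| * (‖U.1‖ * D) := by
    calc -(τ * G) ≤ |τ| * G := by nlinarith [neg_le_abs τ]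
      _ ≤ _ := by gcongr
  rw [h2]
  nlinarith [sq_nonneg (D - |τ| * ‖U.1‖), sq_abs τ]

theorem le_sum_sum_of_nonneg {κ : Type*} [Fintype κ] {f : κ → κ → ℝ} (hf : ∀ i j, 0 ≤ f i j)
    (i j : κ) : f i j ≤ ∑ i, ∑ j, f i j :=
  (Finset.single_le_sum (f := f i) (fun j _ => hf i j) (Finset.mem_univ j)).trans
    (Finset.single_le_sum (f := fun i => ∑ j, f i j)
      (fun i _ => Finset.sum_nonneg fun j _ => hf i j) (Finset.mem_univ i))

theorem Jet.norm_le {U : Jet d} {r : ℝ} (hr : 0 ≤ r) (h : ‖U.1‖ ≤ r) (h1 : ∀ i, ‖U.2.1 i‖ ≤ r)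
    (h2 : ∀ i j, ‖U.2.2 i j‖ ≤ r) : ‖U‖ ≤ r := by
  rw [norm_prod_le_iff, norm_prod_le_iff, pi_norm_le_iff_of_nonneg hr, pi_norm_le_iff_of_nonneg hr]
  exact ⟨h, h1, fun i => (pi_norm_le_iff_of_nonneg hr).2 (h2 i)⟩

theorem H20.norm_sq_le {U : Jet d} (hU : U ∈ H20 Ω) :
    ‖U‖ ^ 2 ≤ 2 * ‖∑ i, U.2.2 i i‖ ^ 2 + 2 * ‖U.1‖ ^ 2 := by
  have hgrad : ∀ i, ‖U.2.1 i‖ ^ 2 ≤ ‖U.1‖ * ‖∑ i, U.2.2 i i‖ := fun i =>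
    le_trans (Finset.single_le_sum (f := fun i => ‖U.2.1 i‖ ^ 2) (fun i _ => sq_nonneg ‖U.2.1 i‖)
      (Finset.mem_univ i)) (H20.norm_grad_sq_le hU)
  have hhess : ∀ i j, ‖U.2.2 i j‖ ^ 2 ≤ ‖∑ i, U.2.2 i i‖ ^ 2 := fun i j => by
    rw [H20.norm_laplacian_sq hU]
    exact le_sum_sum_of_nonneg (f := fun i j => ‖U.2.2 i j‖ ^ 2)
      (fun i j => sq_nonneg ‖U.2.2 i j‖) i j
  generalize ‖∑ i, U.2.2 i i‖ = D at *
  have hsq : 0 ≤ 2 * D ^ 2 + 2 * ‖U.1‖ ^ 2 := by positivity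
  rw [← Real.sq_sqrt hsq]
  refine pow_le_pow_left₀ (norm_nonneg U) (Jet.norm_le (Real.sqrt_nonneg _) ?_ ?_ ?_) 2
  · exact Real.le_sqrt_of_sq_le (by nlinarith [sq_nonneg D, sq_nonneg ‖U.1‖])
  · exact fun i => Real.le_sqrt_of_sq_le
      ((hgrad i).trans (by nlinarith [sq_nonneg (D - ‖U.1‖), sq_nonneg D, sq_nonneg ‖U.1‖]))
  · exact fun i j => Real.le_sqrt_of_sq_le
      ((hhess i j).trans (by nlinarith [sq_nonneg D, sq_nonneg ‖U.1‖]))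

end Jets

/-! ### Compactness of the embedding of `H^2_0` in `L^2` -/

section Rellich

variable {d : ℕ} {Ω : Set (EuclideanSpace ℝ (Fin d))} {φ : EuclideanSpace ℝ (Fin d) → ℝ}

theorem enorm_integral_sq_le_lintegral {α : Type*} [MeasurableSpace α] {μ : Measure α}
    [IsProbabilityMeasure μ] {g : α → ℝ} (hg : AEStronglyMeasurable g μ) :
    ‖∫ x, g x ∂μ‖ₑ ^ 2 ≤ ∫⁻ x, ‖g x‖ₑ ^ 2 ∂μ := by
  have h1 : ‖∫ x, g x ∂μ‖ₑ ≤ eLpNorm g 2 μ := by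
    refine (enorm_integral_le_lintegral_enorm g).trans ?_
    rw [← eLpNorm_one_eq_lintegral_enorm]
    exact eLpNorm_le_eLpNorm_of_exponent_le (by norm_num) hg
  have h2 := eLpNorm_nnreal_pow_eq_lintegral (f := g) (μ := μ) (p := 2) (by norm_num)
  simp only [NNReal.coe_ofNat, ENNReal.rpow_ofNat, ENNReal.coe_ofNat] at h2
  rw [← h2]
  gcongr

theorem lintegral_enorm_translate_sub_sq_le (hφ : IsTest Ω φ) (h : EuclideanSpace ℝ (Fin d)) :
    ∫⁻ x, ‖φ (x + h) - φ x‖ₑ ^ 2 ≤ ‖h‖ₑ ^ 2 * ∫⁻ x, ∑ i, ‖partialDeriv i φ x‖ₑ ^ 2 := by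
  set F : EuclideanSpace ℝ (Fin d) → ENNReal := fun x => ∑ i, ‖partialDeriv i φ x‖ₑ ^ 2 with hF
  have hFc : Measurable F := by
    refine Finset.measurable_fun_sum _ fun i _ => ?_
    exact (contDiff_partialDeriv i hφ.1).continuous.measurable.enorm.pow_const 2
  have hfc : Continuous (fderiv ℝ φ) := hφ.1.continuous_fderiv (by simp)
  have hpt : ∀ x, ‖fderiv ℝ φ x h‖ₑ ^ 2 ≤ ‖h‖ₑ ^ 2 * F x := by
    intro x
    have h1 : fderiv ℝ φ x h = ∑ i, h i * partialDeriv i φ x := by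
      conv_lhs => rw [← (EuclideanSpace.basisFun (Fin d) ℝ).sum_repr h]
      simp [partialDeriv]
    have h2 : (fderiv ℝ φ x h) ^ 2 ≤ ‖h‖ ^ 2 * ∑ i, (partialDeriv i φ x) ^ 2 := by
      rw [h1, EuclideanSpace.norm_sq_eq]
      simp only [Real.norm_eq_abs, sq_abs]
      exact Finset.sum_mul_sq_le_sq_mul_sq _ _ _
    have e : ∀ r : ℝ, ‖r‖ₑ ^ 2 = ENNReal.ofReal (r ^ 2) := fun r => by
      rw [← enorm_pow, Real.enorm_of_nonneg (sq_nonneg r)]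
    have e' : ‖h‖ₑ ^ 2 = ENNReal.ofReal (‖h‖ ^ 2) := by
      rw [← e, enorm_norm]
    simp only [hF, e, e']
    rw [← ENNReal.ofReal_sum_of_nonneg (fun _ _ => sq_nonneg _), ← ENNReal.ofReal_mul (sq_nonneg _)]
    exact ENNReal.ofReal_le_ofReal h2
  have hfund : ∀ x, ‖φ (x + h) - φ x‖ₑ ^ 2 ≤
      ∫⁻ t in Set.Ioc (0 : ℝ) 1, ‖h‖ₑ ^ 2 * F (x + t • h) := by
    intro x
    have hder : ∀ t : ℝ, HasDerivAt (fun t : ℝ => φ (x + t • h)) (fderiv ℝ φ (x + t • h) h) t := by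
      intro t
      have h1 : HasDerivAt (fun t : ℝ => x + t • h) h t := by
        simpa using ((hasDerivAt_id t).smul_const h).const_add x
      exact (hφ.1.differentiable (by simp) _).hasFDerivAt.comp_hasDerivAt t h1
    have hc : Continuous fun t : ℝ => fderiv ℝ φ (x + t • h) h := by fun_prop
    have h1 : φ (x + h) - φ x = ∫ t in Set.Ioc (0 : ℝ) 1, fderiv ℝ φ (x + t • h) h := by
      rw [← intervalIntegral.integral_of_le zero_le_one,
        intervalIntegral.integral_eq_sub_of_hasDerivAt (fun t _ => hder t)
          (hc.intervalIntegrable _ _)]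
      simp
    have : IsProbabilityMeasure (volume.restrict (Set.Ioc (0 : ℝ) 1)) := ⟨by simp⟩
    rw [h1]
    refine (enorm_integral_sq_le_lintegral hc.aestronglyMeasurable).trans ?_
    exact lintegral_mono fun t => hpt _
  calc ∫⁻ x, ‖φ (x + h) - φ x‖ₑ ^ 2
      ≤ ∫⁻ x, ∫⁻ t in Set.Ioc (0 : ℝ) 1, ‖h‖ₑ ^ 2 * F (x + t • h) := lintegral_mono hfund
    _ = ∫⁻ t in Set.Ioc (0 : ℝ) 1, ∫⁻ x, ‖h‖ₑ ^ 2 * F (x + t • h) := by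
        rw [lintegral_lintegral_swap]
        refine Measurable.aemeasurable ?_
        refine measurable_const.mul (hFc.comp ?_)
        fun_prop
    _ = ∫⁻ t in Set.Ioc (0 : ℝ) 1, ‖h‖ₑ ^ 2 * ∫⁻ x, F x := by
        refine lintegral_congr fun t => ?_
        rw [lintegral_const_mul _ (f := fun x => F (x + t • h)) (hFc.comp (by fun_prop)),
          lintegral_add_right_eq_self (fun x => F x) (t • h)]
    _ = ‖h‖ₑ ^ 2 * ∫⁻ x, F x := by simp

/-- The index of the cell of the grid of mesh `ε` that contains `x`. -/
def gridCell (ε : ℝ) (x : EuclideanSpace ℝ (Fin d)) : Fin d → ℤ := fun i => ⌊x i / ε⌋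

theorem measurable_gridCell (ε : ℝ) : Measurable (gridCell (d := d) ε) := by
  refine measurable_pi_lambda _ fun i => ?_
  refine Int.measurable_floor.comp ?_
  exact ((EuclideanSpace.proj i : EuclideanSpace ℝ (Fin d) →L[ℝ] ℝ).measurable).div_const ε

theorem volume_gridCell {ε : ℝ} (hε : 0 < ε) (k : Fin d → ℤ) :
    volume (gridCell ε ⁻¹' {k} : Set (EuclideanSpace ℝ (Fin d))) = ENNReal.ofReal ε ^ d := by
  have h1 : (gridCell ε ⁻¹' {k} : Set (EuclideanSpace ℝ (Fin d))) =
      (WithLp.ofLp : EuclideanSpace ℝ (Fin d) → Fin d → ℝ) ⁻¹'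
        Set.pi Set.univ fun i => Set.Ico ((k i : ℝ) * ε) ((k i + 1) * ε) := by
    ext x
    simp only [Set.mem_preimage, Set.mem_singleton_iff, gridCell, funext_iff, Int.floor_eq_iff,
      Set.mem_pi, Set.mem_univ, true_imp_iff, Set.mem_Ico, le_div_iff₀ hε, div_lt_iff₀ hε]
  rw [h1, (PiLp.volume_preserving_ofLp (Fin d)).measure_preimage
    (MeasurableSet.univ_pi fun i => measurableSet_Ico).nullMeasurableSet, Real.volume_pi_Ico]
  have : ∀ i, ((k i : ℝ) + 1) * ε - k i * ε = ε := fun i => by ring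
  simp [this]

theorem dist_le_of_gridCell_eq {ε : ℝ} (hε : 0 < ε) {x y : EuclideanSpace ℝ (Fin d)}
    (h : gridCell ε x = gridCell ε y) : dist x y ≤ ε * Real.sqrt d := by
  rw [EuclideanSpace.dist_eq, mul_comm, ← Real.sqrt_sq hε.le, ← Real.sqrt_mul (Nat.cast_nonneg d)]
  apply Real.sqrt_le_sqrt
  calc ∑ i, dist (x i) (y i) ^ 2 ≤ ∑ _i : Fin d, ε ^ 2 := by
        refine Finset.sum_le_sum fun i _ => ?_
        have h1 := Int.abs_sub_lt_one_of_floor_eq_floor (congrFun h i)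
        rw [← sub_div, abs_div, abs_of_pos hε, div_lt_one hε] at h1
        rw [Real.dist_eq]
        gcongr
    _ = d * ε ^ 2 := by simp

/-- The mean square deviation of a function from its averages over grid cells. -/
theorem lintegral_sub_average_sq_le (hφ : IsTest Ω φ) {ε : ℝ} (hε : 0 < ε) :
    ∫⁻ x, ‖φ x - ∫ y, φ y ∂(ProbabilityTheory.cond volume (gridCell ε ⁻¹' {gridCell ε x}))‖ₑ ^ 2 ≤
      ENNReal.ofReal (Real.sqrt d) ^ d *
        volume (Metric.closedBall (0 : EuclideanSpace ℝ (Fin d)) 1) *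
        ENNReal.ofReal (ε * Real.sqrt d) ^ 2 * ∫⁻ x, ∑ i, ‖partialDeriv i φ x‖ₑ ^ 2 := by
  set I := ∫⁻ x, ∑ i, ‖partialDeriv i φ x‖ₑ ^ 2
  set r := ε * Real.sqrt d with hr
  have hr0 : 0 ≤ r := by positivity
  have hεd : ENNReal.ofReal ε ^ d ≠ 0 := pow_ne_zero _ (by simpa using hε)
  have hεd' : ENNReal.ofReal ε ^ d ≠ ⊤ := ENNReal.pow_ne_top ENNReal.ofReal_ne_top
  have hm : ∀ k, MeasurableSet (gridCell ε ⁻¹' {k} : Set (EuclideanSpace ℝ (Fin d))) := fun k =>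
    measurable_gridCell ε (measurableSet_singleton k)
  have hpt : ∀ x, ‖φ x - ∫ y, φ y
      ∂(ProbabilityTheory.cond volume (gridCell ε ⁻¹' {gridCell ε x}))‖ₑ ^ 2 ≤
      (ENNReal.ofReal ε ^ d)⁻¹ * ∫⁻ h in Metric.closedBall 0 r, ‖φ (x + h) - φ x‖ₑ ^ 2 := by
    intro x
    set Q : Set (EuclideanSpace ℝ (Fin d)) := gridCell ε ⁻¹' {gridCell ε x} with hQ
    have : IsProbabilityMeasure (ProbabilityTheory.cond volume Q) := by
      apply ProbabilityTheory.cond_isProbabilityMeasure_of_finite <;>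
      rw [hQ, volume_gridCell hε] <;> assumption
    have hint : Integrable φ (ProbabilityTheory.cond volume Q) := by
      rw [ProbabilityTheory.cond]
      refine Integrable.smul_measure ?_ ?_
      · exact (hφ.1.continuous.integrable_of_hasCompactSupport hφ.2.1).integrableOn
      · rw [hQ, volume_gridCell hε]
        exact ENNReal.inv_ne_top.2 hεd
    have h1 : φ x - ∫ y, φ y ∂(ProbabilityTheory.cond volume Q) =
        ∫ y, (φ x - φ y) ∂(ProbabilityTheory.cond volume Q) := by
      rw [integral_sub (integrable_const _) hint]
      simp
    rw [h1]
    refine (enorm_integral_sq_le_lintegral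
      (by have := hφ.1.continuous; fun_prop)).trans ?_
    rw [ProbabilityTheory.cond, lintegral_smul_measure, hQ, volume_gridCell hε, smul_eq_mul]
    refine mul_le_mul_right ?_ _
    rw [← lintegral_indicator (hm _), ← lintegral_indicator Metric.isClosed_closedBall.measurableSet,
      ← lintegral_add_left_eq_self _ x]
    refine lintegral_mono fun h => ?_
    by_cases hh : x + h ∈ gridCell ε ⁻¹' {gridCell ε x}
    · have hball : h ∈ Metric.closedBall (0 : EuclideanSpace ℝ (Fin d)) r := by
        have := dist_le_of_gridCell_eq hε (x := x + h) (y := x) hh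
        simpa [dist_eq_norm] using this
      rw [Set.indicator_of_mem hh, Set.indicator_of_mem hball, ← enorm_neg, neg_sub]
    · rw [Set.indicator_of_notMem hh]
      exact zero_le
  calc _ ≤ ∫⁻ x, (ENNReal.ofReal ε ^ d)⁻¹ * ∫⁻ h in Metric.closedBall 0 r, ‖φ (x + h) - φ x‖ₑ ^ 2 :=
        lintegral_mono hpt
    _ = (ENNReal.ofReal ε ^ d)⁻¹ * ∫⁻ h in Metric.closedBall 0 r, ∫⁻ x, ‖φ (x + h) - φ x‖ₑ ^ 2 := by
        have hmeas : Measurable fun p : EuclideanSpace ℝ (Fin d) × EuclideanSpace ℝ (Fin d) =>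
            ‖φ (p.1 + p.2) - φ p.1‖ₑ ^ 2 := by
          have := hφ.1.continuous.measurable
          fun_prop
        rw [lintegral_const_mul _ (Measurable.lintegral_prod_right' hmeas),
          lintegral_lintegral_swap hmeas.aemeasurable]
    _ ≤ (ENNReal.ofReal ε ^ d)⁻¹ * ∫⁻ h in Metric.closedBall (0 : EuclideanSpace ℝ (Fin d)) r,
          ENNReal.ofReal r ^ 2 * I := by
        refine mul_le_mul_right ?_ _
        refine setLIntegral_mono measurable_const fun h hh => ?_
        refine (lintegral_enorm_translate_sub_sq_le hφ h).trans ?_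
        gcongr
        rw [← ofReal_norm]
        exact ENNReal.ofReal_le_ofReal (by simpa using hh)
    _ = _ := by
        rw [lintegral_const, Measure.restrict_apply_univ, Measure.addHaar_closedBall' _ _ hr0,
          finrank_euclideanSpace, Fintype.card_fin, hr, mul_pow,
          ENNReal.ofReal_mul (p := ε ^ d) (by positivity), ENNReal.ofReal_pow hε.le,
          ENNReal.ofReal_pow (Real.sqrt_nonneg _)]
        calc _ = ((ENNReal.ofReal ε ^ d)⁻¹ * ENNReal.ofReal ε ^ d) *
              (ENNReal.ofReal (Real.sqrt d) ^ d *
                volume (Metric.closedBall (0 : EuclideanSpace ℝ (Fin d)) 1) *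
                ENNReal.ofReal (ε * Real.sqrt d) ^ 2 * I) := by ring
          _ = _ := by rw [ENNReal.inv_mul_cancel hεd hεd', one_mul]

end Rellich

section Rellich

variable {d : ℕ} {Ω : Set (EuclideanSpace ℝ (Fin d))} {φ : EuclideanSpace ℝ (Fin d) → ℝ}

theorem L2.enorm_sq_eq (f : L2 d) : ‖f‖ₑ ^ 2 = ∫⁻ x, ‖f x‖ₑ ^ 2 := by
  have h2 := eLpNorm_nnreal_pow_eq_lintegral (f := f) (μ := (volume : Measure
    (EuclideanSpace ℝ (Fin d)))) (p := 2) (by norm_num)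
  simp only [NNReal.coe_ofNat, ENNReal.rpow_ofNat, ENNReal.coe_ofNat] at h2
  rw [Lp.enorm_def, h2]

theorem finite_image_gridCell (hb : Bornology.IsBounded Ω) {ε : ℝ} (hε : 0 < ε) :
    (gridCell ε '' Ω).Finite := by
  obtain ⟨R, hR⟩ := hb.exists_norm_le
  refine (Set.finite_Icc (fun _ : Fin d => ⌊-R / ε⌋) (fun _ => ⌊R / ε⌋)).subset ?_
  rintro _ ⟨x, hx, rfl⟩
  have h1 : ∀ i, |x i| ≤ R := fun i => (PiLp.norm_apply_le x i).trans (hR x hx)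
  constructor
  · intro i
    apply Int.floor_le_floor
    have := (abs_le.1 (h1 i)).1
    gcongr
  · intro i
    apply Int.floor_le_floor
    have := (abs_le.1 (h1 i)).2
    gcongr

theorem exists_finiteDimensional_approx_test (hb : Bornology.IsBounded Ω) :
    ∃ C : ℝ, 0 ≤ C ∧ ∀ ε > 0, ∃ W : Submodule ℝ (L2 d), FiniteDimensional ℝ W ∧
      ∀ U φ, IsTest Ω φ → IsJetOf U φ → ∃ w ∈ W, ‖U.1 - w‖ ≤ C * ε * ‖U‖ := by
  classical
  set V := volume.real (Metric.closedBall (0 : EuclideanSpace ℝ (Fin d)) 1) with hV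
  have hV0 : 0 ≤ V := measureReal_nonneg
  refine ⟨Real.sqrt (Real.sqrt d ^ d * V * d * d), Real.sqrt_nonneg _, fun ε hε => ?_⟩
  have hm : ∀ k, MeasurableSet (gridCell ε ⁻¹' {k} : Set (EuclideanSpace ℝ (Fin d))) := fun k =>
    measurable_gridCell ε (measurableSet_singleton k)
  have hvol : ∀ k, volume (gridCell ε ⁻¹' {k} : Set (EuclideanSpace ℝ (Fin d))) ≠ ⊤ := fun k => by
    rw [volume_gridCell hε]
    exact ENNReal.pow_ne_top ENNReal.ofReal_ne_top
  set K := (finite_image_gridCell hb hε).toFinset with hK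
  set e : (Fin d → ℤ) → L2 d := fun k => indicatorConstLp 2 (hm k) (hvol k) (1 : ℝ) with he
  refine ⟨Submodule.span ℝ (e '' K), FiniteDimensional.span_of_finite ℝ (K.finite_toSet.image e),
    fun U φ hφ hU => ?_⟩
  set c : (Fin d → ℤ) → ℝ := fun k =>
    ∫ y, φ y ∂(ProbabilityTheory.cond volume (gridCell ε ⁻¹' {k})) with hc
  refine ⟨∑ k ∈ K, c k • e k, Submodule.sum_mem _ fun k hk => Submodule.smul_mem _ _
    (Submodule.subset_span ⟨k, hk, rfl⟩), ?_⟩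
  have hw : ∀ᵐ x, (∑ k ∈ K, c k • e k : L2 d) x = if gridCell ε x ∈ K then c (gridCell ε x) else 0 := by
    have h1 : ∀ᵐ x, ∀ k, (c k • e k : L2 d) x = if gridCell ε x = k then c k else 0 := by
      rw [ae_all_iff]
      intro k
      filter_upwards [Lp.coeFn_smul (c k) (e k), indicatorConstLp_coeFn (p := 2) (hs := hm k)
        (hμs := hvol k) (c := (1 : ℝ))] with x h1 h2
      rw [h1, Pi.smul_apply, he, h2]
      by_cases hx : gridCell ε x = k <;> simp [Set.indicator, hx]
    filter_upwards [h1, Lp.coeFn_fun_finsetSum K (fun k => c k • e k)] with x h1 h2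
    rw [h2]
    simp only [h1]
    rw [Finset.sum_ite_eq]
  have hle : ‖U.1 - ∑ k ∈ K, c k • e k‖ₑ ^ 2 ≤ ENNReal.ofReal (Real.sqrt d) ^ d *
        volume (Metric.closedBall (0 : EuclideanSpace ℝ (Fin d)) 1) *
        ENNReal.ofReal (ε * Real.sqrt d) ^ 2 * ∫⁻ x, ∑ i, ‖partialDeriv i φ x‖ₑ ^ 2 := by
    rw [L2.enorm_sq_eq]
    refine le_trans (lintegral_mono_ae ?_) (lintegral_sub_average_sq_le hφ hε)
    filter_upwards [hw, Lp.coeFn_sub U.1 (∑ k ∈ K, c k • e k), hU.1] with x h1 h2 h3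
    rw [h2, Pi.sub_apply, h1, h3]
    split_ifs with hx
    · exact le_rfl
    · have : φ x = 0 := by
        by_contra h0
        apply hx
        rw [hK, Set.Finite.mem_toFinset]
        exact ⟨x, hφ.2.2 (subset_tsupport φ h0), rfl⟩
      simp [this]
  have hF : ∫⁻ x, ∑ i, ‖partialDeriv i φ x‖ₑ ^ 2 ≤ d * ‖U‖ₑ ^ 2 := by
    rw [lintegral_finsetSum]
    · calc ∑ i, ∫⁻ x, ‖partialDeriv i φ x‖ₑ ^ 2 ≤ ∑ _i : Fin d, ‖U‖ₑ ^ 2 := by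
            refine Finset.sum_le_sum fun i _ => ?_
            have h1 : ∫⁻ x, ‖partialDeriv i φ x‖ₑ ^ 2 = ‖U.2.1 i‖ₑ ^ 2 := by
              rw [L2.enorm_sq_eq]
              refine lintegral_congr_ae ?_
              filter_upwards [hU.2.1 i] with x hx
              rw [hx]
            rw [h1]
            gcongr
            rw [← ofReal_norm, ← ofReal_norm]
            exact ENNReal.ofReal_le_ofReal ((norm_le_pi_norm _ i).trans
              ((norm_fst_le _).trans (norm_snd_le _)))
        _ = d * ‖U‖ₑ ^ 2 := by simp
    · intro i _
      exact (contDiff_partialDeriv i hφ.1).continuous.measurable.enorm.pow_const 2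
  have hle2 := hle.trans (mul_le_mul_right hF _)
  have hVe : volume (Metric.closedBall (0 : EuclideanSpace ℝ (Fin d)) 1) = ENNReal.ofReal V :=
    (ofReal_measureReal (isCompact_closedBall _ _).measure_ne_top).symm
  have hde : (d : ENNReal) = ENNReal.ofReal d := by simp
  rw [hVe, hde, ← ofReal_norm, ← ofReal_norm, ← ENNReal.ofReal_pow (by positivity),
    ← ENNReal.ofReal_pow (by positivity), ← ENNReal.ofReal_pow (by positivity),
    ← ENNReal.ofReal_pow (by positivity), ← ENNReal.ofReal_mul (by positivity),
    ← ENNReal.ofReal_mul (by positivity), ← ENNReal.ofReal_mul (by positivity),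
    ← ENNReal.ofReal_mul (by positivity), ENNReal.ofReal_le_ofReal_iff (by positivity)] at hle2
  refine le_of_sq_le_sq (hle2.trans (le_of_eq ?_)) (by positivity)
  rw [mul_pow, mul_pow, mul_pow, Real.sq_sqrt (by positivity), Real.sq_sqrt (by positivity)]
  ring

theorem exists_finiteDimensional_approx (hb : Bornology.IsBounded Ω) {δ : ℝ} (hδ : 0 < δ) :
    ∃ W : Submodule ℝ (L2 d), FiniteDimensional ℝ W ∧
      ∀ U ∈ H20 Ω, Metric.infDist U.1 W ≤ δ * ‖U‖ := by
  obtain ⟨C, hC, h⟩ := exists_finiteDimensional_approx_test hb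
  obtain ⟨W, hW, h⟩ := h (δ / (C + 1)) (by positivity)
  refine ⟨W, hW, fun U hU => ?_⟩
  refine H20.induction (p := fun U => Metric.infDist U.1 (W : Set (L2 d)) ≤ δ * ‖U‖)
    (isClosed_le ((Metric.continuous_infDist_pt _).comp continuous_fst) (by fun_prop))
    (fun U φ hφ hU => ?_) hU
  obtain ⟨w, hw, hle⟩ := h U φ hφ hU
  refine (Metric.infDist_le_dist_of_mem hw).trans ?_
  rw [dist_eq_norm]
  refine hle.trans ?_
  gcongr
  rw [mul_div_assoc', div_le_iff₀ (by positivity)]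
  nlinarith

theorem totallyBounded_of_finiteDimensional_approx {F : Type*} [NormedAddCommGroup F]
    [NormedSpace ℝ F] {S : Set F} {R : ℝ} (hR : ∀ f ∈ S, ‖f‖ ≤ R)
    (h : ∀ δ > 0, ∃ W : Submodule ℝ F, FiniteDimensional ℝ W ∧
      ∀ f ∈ S, Metric.infDist f W < δ) : TotallyBounded S := by
  rw [Metric.totallyBounded_iff]
  intro ε hε
  obtain ⟨W, hW, h⟩ := h (ε / 2) (by positivity)
  have : ProperSpace W := FiniteDimensional.proper ℝ W
  have hcomp : IsCompact ((↑) '' Metric.closedBall (0 : W) (R + ε / 2) : Set F) :=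
    (isCompact_closedBall _ _).image continuous_subtype_val
  obtain ⟨t, ht, hcov⟩ := Metric.totallyBounded_iff.1 hcomp.totallyBounded (ε / 2) (by positivity)
  refine ⟨t, ht, fun f hf => ?_⟩
  obtain ⟨w, hw, hfw⟩ := (Metric.infDist_lt_iff ⟨0, W.zero_mem⟩).1 (h f hf)
  have hwn : ‖w‖ ≤ R + ε / 2 := by
    have h1 := norm_sub_norm_le w f
    rw [dist_comm, dist_eq_norm] at hfw
    linarith [hR f hf]
  obtain ⟨y, hy, hwy⟩ := Set.mem_iUnion₂.1 (hcov ⟨⟨w, hw⟩, by simpa using hwn, rfl⟩)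
  refine Set.mem_iUnion₂.2 ⟨y, hy, ?_⟩
  rw [Metric.mem_ball] at hwy ⊢
  exact (dist_triangle f w y).trans_lt (by linarith)

/-- **Rellich's theorem** for `H^2_0` of a bounded set. -/
theorem H20.exists_subseq_cauchySeq (hb : Bornology.IsBounded Ω) (x : ℕ → H20 Ω) (R : ℝ)
    (hx : ∀ n, ‖x n‖ ≤ R) :
    ∃ ψ : ℕ → ℕ, StrictMono ψ ∧ CauchySeq fun n => H20.toL2 Ω (x (ψ n)) := by
  have hR : 0 ≤ R := (norm_nonneg _).trans (hx 0)
  have htb : TotallyBounded (Set.range fun n => H20.toL2 Ω (x n)) := by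
    refine totallyBounded_of_finiteDimensional_approx (R := R) ?_ fun δ hδ => ?_
    · rintro _ ⟨n, rfl⟩
      exact (norm_fst_le _).trans (hx n)
    · obtain ⟨W, hW, h⟩ := exists_finiteDimensional_approx hb (δ := δ / (R + 1)) (by positivity)
      refine ⟨W, hW, ?_⟩
      rintro _ ⟨n, rfl⟩
      refine (h _ (x n).2).trans_lt ?_
      have h1 : ‖(x n : Jet d)‖ ≤ R := hx n
      calc δ / (R + 1) * ‖(x n : Jet d)‖ ≤ δ / (R + 1) * R := by gcongr
        _ < δ := by
          rw [div_mul_eq_mul_div, div_lt_iff₀ (by positivity)]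
          nlinarith
  obtain ⟨z, -, ψ, hψ, hz⟩ := (htb.closure.isCompact_of_isClosed isClosed_closure).tendsto_subseq
    fun n => subset_closure (Set.mem_range_self n)
  exact ⟨ψ, hψ, hz.cauchySeq⟩

theorem IsTest.exists_isJetOf (h : IsTest Ω φ) : ∃ U, IsJetOf U φ :=
  ⟨(h.memLp.toLp, fun i => (h.partialDeriv i).memLp.toLp,
    fun i j => ((h.partialDeriv j).partialDeriv i).memLp.toLp),
    h.memLp.coeFn_toLp, fun i => (h.partialDeriv i).memLp.coeFn_toLp,
    fun i j => ((h.partialDeriv j).partialDeriv i).memLp.coeFn_toLp⟩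

theorem exists_test_family [Nonempty (Fin d)] (ho : IsOpen Ω) (hne : Ω.Nonempty) (n : ℕ) :
    ∃ (x : Fin n → EuclideanSpace ℝ (Fin d)) (f : Fin n → EuclideanSpace ℝ (Fin d) → ℝ),
      (∀ i, IsTest Ω (f i)) ∧ ∀ i j, f i (x j) = if i = j then 1 else 0 := by
  have hinf : Ω.Infinite := by
    obtain ⟨x, hx⟩ := hne
    exact infinite_of_mem_nhds x (ho.mem_nhds hx)
  let g := hinf.natEmbedding
  set x : Fin n → EuclideanSpace ℝ (Fin d) := fun i => g i with hx
  have hxinj : Function.Injective x := fun i j hij =>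
    Fin.ext (g.injective (Subtype.ext hij))
  have hr : ∃ r > 0, (∀ i, Metric.closedBall (x i) r ⊆ Ω) ∧ ∀ i j, i ≠ j → r < dist (x j) (x i) := by
    have h1 : ∀ᶠ r in nhdsWithin (0 : ℝ) (Set.Ioi 0), ∀ i, Metric.closedBall (x i) r ⊆ Ω := by
      rw [Filter.eventually_all]
      intro i
      obtain ⟨ε, hε, h⟩ := Metric.nhds_basis_closedBall.mem_iff.1 (ho.mem_nhds (g i).2)
      filter_upwards [Ioo_mem_nhdsGT hε] with r hr
      exact (Metric.closedBall_subset_closedBall hr.2.le).trans h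
    have h2 : ∀ᶠ r in nhdsWithin (0 : ℝ) (Set.Ioi 0), ∀ i j, i ≠ j → r < dist (x j) (x i) := by
      rw [Filter.eventually_all]
      intro i
      rw [Filter.eventually_all]
      intro j
      by_cases hij : i = j
      · simp [hij]
      · filter_upwards [Ioo_mem_nhdsGT (dist_pos.2 fun h => hij (hxinj h).symm)] with r hr _
        exact hr.2
    obtain ⟨r, ⟨h1, h2⟩, h3⟩ := ((h1.and h2).and self_mem_nhdsWithin).exists
    exact ⟨r, h3, h1, h2⟩
  obtain ⟨r, hr0, hrΩ, hrd⟩ := hr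
  let b : ∀ i, ContDiffBump (x i) := fun i => ⟨r / 2, r, by positivity, half_lt_self hr0⟩
  refine ⟨x, fun i => b i, fun i => ⟨(b i).contDiff, (b i).hasCompactSupport, ?_⟩, fun i j => ?_⟩
  · rw [(b i).tsupport_eq]
    exact hrΩ i
  · split_ifs with hij
    · subst hij
      exact (b i).one_of_mem_closedBall (Metric.mem_closedBall_self (b i).rIn_pos.le)
    · exact (b i).zero_of_le_dist (hrd i j hij).le

theorem H20.exists_orthogonal [Nonempty (Fin d)] (ho : IsOpen Ω) (hne : Ω.Nonempty) (n : ℕ)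
    (f : ℕ → L2 d) :
    ∃ U : H20 Ω, H20.toL2 Ω U ≠ 0 ∧ ∀ i < n, inner ℝ (f i) (H20.toL2 Ω U) = 0 := by
  obtain ⟨x, φ, hφ, hx⟩ := exists_test_family ho hne (n + 1)
  choose J hJ using fun i => (hφ i).exists_isJetOf
  let J' : Fin (n + 1) → H20 Ω := fun i =>
    ⟨J i, Submodule.le_topologicalClosure _ ⟨φ i, hφ i, hJ i⟩⟩
  let F : (Fin (n + 1) → ℝ) →ₗ[ℝ] (Fin n → ℝ) :=
    { toFun := fun c j => ∑ i, c i * inner ℝ (f j) (H20.toL2 Ω (J' i))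
      map_add' := fun c c' => by
        ext j
        simp only [Pi.add_apply, add_mul, Finset.sum_add_distrib]
      map_smul' := fun r c => by
        ext j
        simp only [Pi.smul_apply, smul_eq_mul, mul_assoc, Finset.mul_sum, RingHom.id_apply] }
  have hker : LinearMap.ker F ≠ ⊥ := LinearMap.ker_ne_bot_of_finrank_lt (by simp)
  obtain ⟨c, hcF, hc0⟩ := Submodule.exists_mem_ne_zero_of_ne_bot hker
  have hsum : H20.toL2 Ω (∑ i, c i • J' i) = ∑ i, c i • (J i).1 := by
    simp only [map_sum, map_smul]
    rfl
  refine ⟨∑ i, c i • J' i, fun h0 => hc0 ?_, fun j hj => ?_⟩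
  · rw [hsum] at h0
    have hae : (fun y => ∑ i, c i * φ i y) =ᵐ[volume] fun _ => (0 : ℝ) := by
      have h1 : ∀ᵐ y, ∀ i, (c i • (J i).1 : L2 d) y = c i * φ i y := by
        rw [ae_all_iff]
        intro i
        filter_upwards [Lp.coeFn_smul (c i) (J i).1, (hJ i).1] with y h1 h2
        rw [h1, Pi.smul_apply, h2, smul_eq_mul]
      have h2 := Lp.coeFn_fun_finsetSum Finset.univ (fun i => c i • (J i).1)
      rw [h0] at h2
      filter_upwards [h1, h2, Lp.coeFn_zero ℝ 2 (volume : Measure (EuclideanSpace ℝ (Fin d)))]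
        with y h1 h2 h3
      rw [h3] at h2
      simp only [h1] at h2
      exact h2.symm
    have heq := (Continuous.ae_eq_iff_eq volume
      (continuous_finsetSum _ fun i _ => continuous_const.mul (hφ i).1.continuous)
      continuous_const).1 hae
    funext j
    have := congrFun heq (x j)
    simpa [hx] using this
  · have := congrFun (LinearMap.mem_ker.1 hcF) ⟨j, hj⟩
    rw [map_sum, inner_sum]
    simpa [F, inner_smul_right] using this

theorem isCompactForm_plateBilin [Nonempty (Fin d)] (ho : IsOpen Ω) (hne : Ω.Nonempty)
    (hb : Bornology.IsBounded Ω) (τ : ℝ) : IsCompactForm (plateBilin Ω τ) (H20.toL2 Ω) where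
  symm U V := plateForm_comm τ _ _
  cont := (continuous_plateForm_self τ).comp continuous_subtype_val
  coercive := by
    refine ⟨4, (τ ^ 2 + 1) / 2, by norm_num, fun U => ?_⟩
    have h1 := H20.norm_laplacian_sq_le τ U.2
    have h2 := H20.norm_sq_le U.2
    rw [plateBilin_apply, H20.toL2_apply]
    rw [Submodule.coe_norm]
    linarith
  compact := H20.exists_subseq_cauchySeq hb
  infinite := H20.exists_orthogonal ho hne

end Rellich

/-! ### Sums of plate eigenvalues -/

section PlateSum

variable {d : ℕ} {Ω : Set (EuclideanSpace ℝ (Fin d))} {τ : ℝ} {n : ℕ} {u : ℕ → H20 Ω} {γ : ℕ → ℝ}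

theorem plateSum_eq (h : IsLowestEigenvectors (plateBilin Ω τ) (H20.toL2 Ω) n u γ) :
    plateSum Ω τ n = ∑ k ∈ Finset.range n, γ k := by
  rw [plateSum, ← Finset.Ico_add_one_right_eq_Icc, Finset.sum_Ico_eq_sum_range]
  refine Finset.sum_congr (by simp) fun k hk => ?_
  rw [← h.sInf_eq (fun U V => plateForm_comm τ _ _) (Finset.mem_range.1 (by simpa using hk)),
    add_comm, plateEigenvalue]
  congr 1
  ext t
  constructor
  · rintro ⟨U, hU, hE⟩
    choose Γ hΓ hE using hE
    exact ⟨fun i => ⟨U i, (hE i).1⟩, hU, fun i => ⟨Γ i, hΓ i, fun V => (hE i).2.2 V V.2⟩⟩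
  · rintro ⟨U, hU, hE⟩
    choose Γ hΓ hE using hE
    exact ⟨fun i => U i, hU, fun i => ⟨Γ i, hΓ i, (U i).2, hU.ne_zero i, fun V hV =>
      hE i ⟨V, hV⟩⟩⟩

theorem plateSum_le [Nonempty (Fin d)] (ho : IsOpen Ω) (hne : Ω.Nonempty)
    (hb : Bornology.IsBounded Ω) (τ : ℝ) {v : Fin n → H20 Ω}
    (hv : Orthonormal ℝ fun i => H20.toL2 Ω (v i)) :
    plateSum Ω τ n ≤ ∑ i, plateBilin Ω τ (v i) (v i) := by
  obtain ⟨u, γ, h⟩ := (isCompactForm_plateBilin ho hne hb τ).exists_isLowestEigenvectors n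
  rw [plateSum_eq h]
  exact h.sum_le (fun U V => plateForm_comm τ _ _) hv

end PlateSum

/-! ### Affine changes of variables -/

section Pullback

variable {d : ℕ} (L : EuclideanSpace ℝ (Fin d) ≃ₗ[ℝ] EuclideanSpace ℝ (Fin d))
  (c : EuclideanSpace ℝ (Fin d))

/-- The affine map `x ↦ L x + c` as a homeomorphism. -/
def affineHomeo : EuclideanSpace ℝ (Fin d) ≃ₜ EuclideanSpace ℝ (Fin d) :=
  L.toContinuousLinearEquiv.toHomeomorph.trans (Homeomorph.addRight c)

@[simp]
theorem affineHomeo_apply (x : EuclideanSpace ℝ (Fin d)) : affineHomeo L c x = L x + c := rfl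

/-- The factor by which `L⁻¹` scales volumes. -/
def invDet : ℝ := |(LinearMap.det (L : EuclideanSpace ℝ (Fin d) →ₗ[ℝ] _))⁻¹|

theorem invDet_pos : 0 < invDet L := abs_pos.2 (inv_ne_zero L.isUnit_det'.ne_zero)

theorem measurePreserving_affineHomeo :
    MeasurePreserving (affineHomeo L c) volume (ENNReal.ofReal (invDet L) • volume) := by
  refine ⟨(affineHomeo L c).continuous.measurable, ?_⟩
  have h1 : (affineHomeo L c : EuclideanSpace ℝ (Fin d) → _) =
      (fun x => x + c) ∘ (L : EuclideanSpace ℝ (Fin d) →ₗ[ℝ] _) := rfl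
  rw [h1, ← Measure.map_map (measurable_add_const c)
    (show Measurable (L : EuclideanSpace ℝ (Fin d) →ₗ[ℝ] EuclideanSpace ℝ (Fin d)) from
      L.toContinuousLinearEquiv.continuous.measurable),
    Measure.map_linearMap_addHaar_eq_smul_addHaar _ L.isUnit_det'.ne_zero, Measure.map_smul,
    map_add_right_eq_self]
  rfl

theorem ae_comp_affineHomeo {p : EuclideanSpace ℝ (Fin d) → Prop} (h : ∀ᵐ x, p x) :
    ∀ᵐ x, p (affineHomeo L c x) :=
  (measurePreserving_affineHomeo L c).quasiMeasurePreserving.ae (Measure.ae_smul_measure h _)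

theorem memLp_comp_affineHomeo (f : L2 d) : MemLp (fun x => f (affineHomeo L c x)) 2 volume :=
  ((Lp.memLp f).smul_measure ENNReal.ofReal_ne_top).comp_measurePreserving
    (measurePreserving_affineHomeo L c)

/-- Composition with an affine map as a linear map on `L^2`. -/
def L2.compₗ : L2 d →ₗ[ℝ] L2 d where
  toFun f := (memLp_comp_affineHomeo L c f).toLp
  map_add' f g := by
    apply Lp.ext
    filter_upwards [(memLp_comp_affineHomeo L c (f + g)).coeFn_toLp,
      (memLp_comp_affineHomeo L c f).coeFn_toLp, (memLp_comp_affineHomeo L c g).coeFn_toLp,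
      Lp.coeFn_add (memLp_comp_affineHomeo L c f).toLp (memLp_comp_affineHomeo L c g).toLp,
      ae_comp_affineHomeo L c (Lp.coeFn_add f g)] with x h1 h2 h3 h4 h5
    rw [h1, h4, Pi.add_apply, h2, h3, h5, Pi.add_apply]
  map_smul' r f := by
    apply Lp.ext
    filter_upwards [(memLp_comp_affineHomeo L c (r • f)).coeFn_toLp,
      (memLp_comp_affineHomeo L c f).coeFn_toLp,
      Lp.coeFn_smul r (memLp_comp_affineHomeo L c f).toLp,
      ae_comp_affineHomeo L c (Lp.coeFn_smul r f)] with x h1 h2 h3 h4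
    rw [RingHom.id_apply, h1, h3, Pi.smul_apply, h2, h4, Pi.smul_apply]

theorem L2.compₗ_ae (f : L2 d) : L2.compₗ L c f =ᵐ[volume] fun x => f (affineHomeo L c x) :=
  (memLp_comp_affineHomeo L c f).coeFn_toLp

theorem L2.compₗ_ae_of_ae {f : L2 d} {φ : EuclideanSpace ℝ (Fin d) → ℝ} (h : f =ᵐ[volume] φ) :
    L2.compₗ L c f =ᵐ[volume] fun x => φ (affineHomeo L c x) :=
  (L2.compₗ_ae L c f).trans (ae_comp_affineHomeo L c h)

theorem L2.inner_compₗ (f g : L2 d) :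
    inner ℝ (L2.compₗ L c f) (L2.compₗ L c g) = invDet L * inner ℝ f g := by
  rw [L2.inner_eq_integral (L2.compₗ_ae L c f) (L2.compₗ_ae L c g),
    L2.inner_eq_integral (Filter.EventuallyEq.refl _ f) (Filter.EventuallyEq.refl _ g),
    (measurePreserving_affineHomeo L c).integral_comp (affineHomeo L c).measurableEmbedding
      (fun x => f x * g x), integral_smul_measure, ENNReal.toReal_ofReal (invDet_pos L).le,
    smul_eq_mul]

theorem L2.norm_compₗ (f : L2 d) : ‖L2.compₗ L c f‖ = Real.sqrt (invDet L) * ‖f‖ := by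
  rw [← Real.sqrt_sq (norm_nonneg f), ← Real.sqrt_mul (invDet_pos L).le,
    ← real_inner_self_eq_norm_sq, ← L2.inner_compₗ L c, real_inner_self_eq_norm_sq,
    Real.sqrt_sq (norm_nonneg _)]

theorem L2.continuous_compₗ : Continuous (L2.compₗ (d := d) L c) :=
  (L2.compₗ L c).mkContinuous (Real.sqrt (invDet L)) (fun f => (L2.norm_compₗ L c f).le)
    |>.continuous

/-- The matrix of a linear map in the standard basis. -/
def stdMatrix (A : EuclideanSpace ℝ (Fin d) →ₗ[ℝ] EuclideanSpace ℝ (Fin d)) :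
    Matrix (Fin d) (Fin d) ℝ :=
  LinearMap.toMatrix (EuclideanSpace.basisFun (Fin d) ℝ).toBasis
    (EuclideanSpace.basisFun (Fin d) ℝ).toBasis A

theorem stdMatrix_apply (A : EuclideanSpace ℝ (Fin d) →ₗ[ℝ] EuclideanSpace ℝ (Fin d))
    (k i : Fin d) : stdMatrix A k i = A (EuclideanSpace.single i 1) k := by
  simp [stdMatrix, LinearMap.toMatrix_apply]

/-- The pullback of a jet under `x ↦ L x + c`. -/
def pullJet (U : Jet d) : Jet d :=
  (L2.compₗ L c U.1, fun i => ∑ k, stdMatrix L.toLinearMap k i • L2.compₗ L c (U.2.1 k),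
    fun i j => ∑ k, ∑ l, (stdMatrix L.toLinearMap k i * stdMatrix L.toLinearMap l j) •
      L2.compₗ L c (U.2.2 k l))

theorem continuous_pullJet : Continuous (pullJet (d := d) L c) := by
  have := L2.continuous_compₗ (d := d) L c
  unfold pullJet
  fun_prop

variable {Ω : Set (EuclideanSpace ℝ (Fin d))} {φ : EuclideanSpace ℝ (Fin d) → ℝ}

theorem IsTest.comp_affineHomeo (h : IsTest Ω φ) :
    IsTest (affineHomeo L c ⁻¹' Ω) (fun x => φ (affineHomeo L c x)) := by
  refine ⟨?_, h.2.1.comp_homeomorph (affineHomeo L c), ?_⟩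
  · refine h.1.comp ?_
    exact (L.toContinuousLinearEquiv.contDiff).add contDiff_const
  · have := tsupport_comp_eq_preimage φ (affineHomeo L c)
    rw [show (fun x => φ (affineHomeo L c x)) = φ ∘ affineHomeo L c from rfl, this]
    exact Set.preimage_mono h.2.2

theorem partialDeriv_comp_affineHomeo (h : ContDiff ℝ ∞ φ) (i : Fin d)
    (x : EuclideanSpace ℝ (Fin d)) :
    partialDeriv i (fun x => φ (affineHomeo L c x)) x =
      ∑ k, stdMatrix L.toLinearMap k i * partialDeriv k φ (affineHomeo L c x) := by
  have h1 : HasFDerivAt (affineHomeo L c)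
      (L.toContinuousLinearEquiv : EuclideanSpace ℝ (Fin d) →L[ℝ] EuclideanSpace ℝ (Fin d)) x :=
    (L.toContinuousLinearEquiv.hasFDerivAt).add_const c
  have h2 := ((h.differentiable (by simp) (affineHomeo L c x)).hasFDerivAt.comp x h1).fderiv
  have h3 : partialDeriv i (fun x => φ (affineHomeo L c x)) x =
      fderiv ℝ φ (affineHomeo L c x) (L (EuclideanSpace.single i 1)) := by
    rw [partialDeriv, show (fun x => φ (affineHomeo L c x)) = φ ∘ affineHomeo L c from rfl, h2]
    rfl
  rw [h3]
  conv_lhs => rw [← (EuclideanSpace.basisFun (Fin d) ℝ).sum_repr (L (EuclideanSpace.single i 1))]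
  simp [partialDeriv, stdMatrix_apply]

theorem L2.sum_smul_ae {κ : Type*} [Fintype κ] (r : κ → ℝ) {f : κ → L2 d}
    {g : κ → EuclideanSpace ℝ (Fin d) → ℝ} (h : ∀ k, f k =ᵐ[volume] g k) :
    (∑ k, r k • f k : L2 d) =ᵐ[volume] fun x => ∑ k, r k * g k x := by
  have h1 : ∀ᵐ y, ∀ k, (r k • f k : L2 d) y = r k * g k y := by
    rw [ae_all_iff]
    intro k
    filter_upwards [Lp.coeFn_smul (r k) (f k), h k] with y h1 h2
    rw [h1, Pi.smul_apply, h2, smul_eq_mul]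
  filter_upwards [h1, Lp.coeFn_fun_finsetSum Finset.univ (fun k => r k • f k)] with y h1 h2
  rw [h2]
  exact Finset.sum_congr rfl fun k _ => h1 k

theorem IsJetOf.pullJet {U : Jet d} (hφ : IsTest Ω φ) (hU : IsJetOf U φ) :
    IsJetOf (pullJet L c U) (fun x => φ (affineHomeo L c x)) := by
  refine ⟨L2.compₗ_ae_of_ae L c hU.1, fun i => ?_, fun i j => ?_⟩
  · refine (L2.sum_smul_ae _ fun k => L2.compₗ_ae_of_ae L c (hU.2.1 k)).trans ?_
    refine Filter.Eventually.of_forall fun x => ?_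
    exact (partialDeriv_comp_affineHomeo L c hφ.1 i x).symm
  · have h1 := L2.sum_smul_ae (κ := Fin d × Fin d)
      (fun p => stdMatrix L.toLinearMap p.1 i * stdMatrix L.toLinearMap p.2 j)
      fun p => L2.compₗ_ae_of_ae L c (hU.2.2 p.1 p.2)
    rw [Fintype.sum_prod_type] at h1
    refine h1.trans (Filter.Eventually.of_forall fun x => ?_)
    have h2 : partialDeriv j (fun x => φ (affineHomeo L c x)) = ∑ l, stdMatrix L.toLinearMap l j •
        fun x => partialDeriv l φ (affineHomeo L c x) := by
      funext y
      rw [partialDeriv_comp_affineHomeo L c hφ.1 j y]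
      simp
    have h3 : ∀ l, ContDiff ℝ ∞ fun x => partialDeriv l φ (affineHomeo L c x) := fun l =>
      ((hφ.partialDeriv l).comp_affineHomeo L c).1
    have h4 : partialDeriv i (∑ l, stdMatrix L.toLinearMap l j •
        fun x => partialDeriv l φ (affineHomeo L c x)) x = ∑ l, stdMatrix L.toLinearMap l j *
        partialDeriv i (fun x => partialDeriv l φ (affineHomeo L c x)) x := by
      have h5 : ∀ l, DifferentiableAt ℝ (stdMatrix L.toLinearMap l j •
          fun x => partialDeriv l φ (affineHomeo L c x)) x := fun l =>
        ((h3 l).differentiable (by simp) x).const_smul _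
      rw [partialDeriv, fderiv_sum fun l _ => h5 l, sum_apply]
      refine Finset.sum_congr rfl fun l _ => ?_
      have := congrFun (partialDeriv_smul i (stdMatrix L.toLinearMap l j) (h3 l)) x
      exact this
    simp only
    rw [Fintype.sum_prod_type, h2, h4, Finset.sum_comm]
    refine Finset.sum_congr rfl fun l _ => ?_
    rw [partialDeriv_comp_affineHomeo L c (contDiff_partialDeriv l hφ.1) i x, Finset.mul_sum]
    exact Finset.sum_congr rfl fun k _ => by ring

theorem pullJet_mem_H20 {U : Jet d} (hU : U ∈ H20 Ω) :
    pullJet L c U ∈ H20 (affineHomeo L c ⁻¹' Ω) := by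
  refine H20.induction (p := fun U => pullJet L c U ∈ H20 (affineHomeo L c ⁻¹' Ω))
    ((Submodule.isClosed_topologicalClosure _).preimage (continuous_pullJet L c))
    (fun U φ hφ hUφ => ?_) hU
  exact Submodule.le_topologicalClosure _ ⟨_, hφ.comp_affineHomeo L c, hUφ.pullJet L c hφ⟩

/-- The plate form of a jet, with the Laplacian replaced by `∑ N k l ∂ₖ∂ₗ` and `|∇u|²` by
`∑ N k l ∂ₖu ∂ₗu`. -/
def anisoForm (τ : ℝ) (N : Matrix (Fin d) (Fin d) ℝ) (U : Jet d) : ℝ :=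
  ∑ k, ∑ l, ∑ m, ∑ p, N k l * N m p * inner ℝ (U.2.2 k l) (U.2.2 m p) +
    τ * ∑ k, ∑ l, N k l * inner ℝ (U.2.1 k) (U.2.1 l)

theorem plateForm_pullJet (τ : ℝ) (U : Jet d) :
    plateForm τ (pullJet L c U) (pullJet L c U) =
      invDet L * anisoForm τ (stdMatrix L.toLinearMap * (stdMatrix L.toLinearMap).transpose) U := by
  set a := stdMatrix L.toLinearMap with ha
  have h1 : ∑ i, (pullJet L c U).2.2 i i =
      ∑ k, ∑ l, (a * a.transpose) k l • L2.compₗ L c (U.2.2 k l) := by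
    simp only [pullJet, Matrix.mul_apply, Matrix.transpose_apply, Finset.sum_smul]
    rw [Finset.sum_comm]
    exact Finset.sum_congr rfl fun k _ => Finset.sum_comm
  have h2 : ∑ i, inner ℝ ((pullJet L c U).2.1 i) ((pullJet L c U).2.1 i) =
      invDet L * ∑ k, ∑ l, (a * a.transpose) k l * inner ℝ (U.2.1 k) (U.2.1 l) := by
    simp only [pullJet, sum_inner, inner_sum, inner_smul_left, inner_smul_right, L2.inner_compₗ,
      RCLike.conj_to_real, Matrix.mul_apply, Matrix.transpose_apply, Finset.sum_mul,
      Finset.mul_sum]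
    rw [Finset.sum_comm]
    refine Finset.sum_congr rfl fun k _ => ?_
    rw [Finset.sum_comm]
    exact Finset.sum_congr rfl fun l _ => Finset.sum_congr rfl fun i _ => by
      rw [ha, real_inner_comm (U.2.1 k) (U.2.1 l)]
      ring
  rw [plateForm, h1, h2, anisoForm]
  simp only [sum_inner, inner_sum, inner_smul_left, inner_smul_right, L2.inner_compₗ,
    RCLike.conj_to_real, mul_add, Finset.mul_sum]
  congr 1
  · refine Finset.sum_congr rfl fun k _ => Finset.sum_congr rfl fun l _ =>
      Finset.sum_congr rfl fun m _ => Finset.sum_congr rfl fun p _ => ?_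
    rw [real_inner_comm]
    ring
  · refine Finset.sum_congr rfl fun k _ => Finset.sum_congr rfl fun l _ => by ring

theorem plateSum_preimage_le [Nonempty (Fin d)] (ho : IsOpen Ω) (hne : Ω.Nonempty)
    (hb : Bornology.IsBounded (affineHomeo L c ⁻¹' Ω)) {a : LinearMap.BilinForm ℝ (H20 Ω)} {n : ℕ}
    {u : ℕ → H20 Ω} {γ : ℕ → ℝ} (h : IsLowestEigenvectors a (H20.toL2 Ω) n u γ) (τ : ℝ) :
    plateSum (affineHomeo L c ⁻¹' Ω) τ n ≤ ∑ j ∈ Finset.range n,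
      anisoForm τ (stdMatrix L.toLinearMap * (stdMatrix L.toLinearMap).transpose) (u j : Jet d) := by
  have hκ := invDet_pos L
  set v : Fin n → H20 (affineHomeo L c ⁻¹' Ω) := fun i =>
    (Real.sqrt (invDet L))⁻¹ • ⟨pullJet L c (u i), pullJet_mem_H20 L c (u i).2⟩ with hv
  have hsq : (Real.sqrt (invDet L))⁻¹ * (Real.sqrt (invDet L))⁻¹ = (invDet L)⁻¹ := by
    rw [← mul_inv, Real.mul_self_sqrt hκ.le]
  have hvo : Orthonormal ℝ fun i => H20.toL2 (affineHomeo L c ⁻¹' Ω) (v i) := by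
    rw [orthonormal_iff_ite]
    intro i j
    have h1 := h.orthonormal i i.2 j j.2
    simp only [H20.toL2_apply] at h1
    simp only [hv, map_smul, inner_smul_left, inner_smul_right, RCLike.conj_to_real,
      H20.toL2_apply, pullJet, L2.inner_compₗ]
    rw [h1, ← mul_assoc, hsq, ← mul_assoc, inv_mul_cancel₀ hκ.ne', one_mul]
    simp [Fin.ext_iff]
  refine (plateSum_le (ho.preimage (affineHomeo L c).continuous)
    ((affineHomeo L c).surjective.nonempty_preimage.2 hne) hb τ hvo).trans (le_of_eq ?_)
  rw [← Fin.sum_univ_eq_sum_range (fun j => anisoForm τ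
    (stdMatrix L.toLinearMap * (stdMatrix L.toLinearMap).transpose) (u j : Jet d))]
  refine Finset.sum_congr rfl fun i _ => ?_
  simp only [hv, map_smul, LinearMap.smul_apply, smul_eq_mul, plateBilin_apply]
  rw [plateForm_pullJet, ← mul_assoc, hsq, ← mul_assoc, inv_mul_cancel₀ hκ.ne', one_mul]

end Pullback

/-! ### Averaging over a group of orthogonal matrices -/

section Averaging

variable {d : ℕ}

instance : CompactSpace (Matrix.orthogonalGroup (Fin d) ℝ) := by
  have hK : IsCompact {A : Matrix (Fin d) (Fin d) ℝ | ∀ i j, ‖A i j‖ ≤ 1} := by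
    have h := isCompact_univ_pi fun _ : Fin d => isCompact_univ_pi fun _ : Fin d =>
      isCompact_closedBall (0 : ℝ) 1
    have e : {A : Fin d → Fin d → ℝ | ∀ i j, ‖A i j‖ ≤ 1} = Set.pi Set.univ fun _ : Fin d =>
        Set.pi Set.univ fun _ : Fin d => Metric.closedBall (0 : ℝ) 1 := by
      ext
      simp
    rw [← e] at h
    exact h
  refine isCompact_iff_compactSpace.1 (hK.of_isClosed_subset
    (t := ((Matrix.orthogonalGroup (Fin d) ℝ : Submonoid _) : Set (Matrix (Fin d) (Fin d) ℝ)))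
    ?_ ?_)
  · have h1 : ((Matrix.orthogonalGroup (Fin d) ℝ : Submonoid _) : Set (Matrix (Fin d) (Fin d) ℝ)) =
        {A | A * star A = 1} := by
      ext A
      exact Matrix.mem_orthogonalGroup_iff (Fin d) ℝ
    rw [h1]
    exact isClosed_eq (continuous_id.mul continuous_star) continuous_const
  · exact fun A hA i j => entry_norm_bound_of_unitary (𝕜 := ℝ) hA i j

/-- An invariant mean over a group of orthogonal matrices, as a positive functional on continuous
functions of a matrix. -/
structure InvariantMean {Γ : Type*} [Group Γ] (ρ : Γ →* Matrix.orthogonalGroup (Fin d) ℝ) where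
  mean : C(Matrix (Fin d) (Fin d) ℝ, ℝ) →ₗ[ℝ] ℝ
  mean_one : mean 1 = 1
  nonneg : ∀ f, (∀ g, 0 ≤ f (ρ g)) → 0 ≤ mean f
  invariant : ∀ h f f', (∀ A, f' A = f (ρ h * A)) → mean f' = mean f

variable {Γ : Type*} [Group Γ] (ρ : Γ →* Matrix.orthogonalGroup (Fin d) ℝ)

theorem nonempty_invariantMean : Nonempty (InvariantMean ρ) := by
  set G := ρ.range.topologicalClosure with hG
  have : CompactSpace G := isCompact_iff_compactSpace.1
    (Subgroup.isClosed_topologicalClosure ρ.range).isCompact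
  let _ : MeasurableSpace G := borel G
  have : BorelSpace G := ⟨rfl⟩
  set μ : Measure G := Measure.haarMeasure ⊤ with hμ
  have : IsProbabilityMeasure μ := ⟨by
    simpa using Measure.haarMeasure_self (K₀ := (⊤ : TopologicalSpace.PositiveCompacts G))⟩
  let ev : G → Matrix (Fin d) (Fin d) ℝ := fun g => ((g : Matrix.orthogonalGroup (Fin d) ℝ) : _)
  have hev : Continuous ev := continuous_subtype_val.comp continuous_subtype_val
  have hint : ∀ f : C(Matrix (Fin d) (Fin d) ℝ, ℝ), Integrable (fun g => f (ev g)) μ := fun f =>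
    (f.continuous.comp hev).integrable_of_hasCompactSupport (HasCompactSupport.of_compactSpace _)
  refine ⟨⟨⟨⟨fun f => ∫ g, f (ev g) ∂μ, fun f f' => ?_⟩, fun c f => ?_⟩, ?_, fun f hf => ?_,
    fun h f f' hff' => ?_⟩⟩
  · exact integral_add (hint f) (hint f')
  · exact integral_const_mul c _
  · change ∫ g : G, (1 : ℝ) ∂μ = 1
    simp
  · refine integral_nonneg fun g => ?_
    have hclosed : IsClosed {A : Matrix.orthogonalGroup (Fin d) ℝ | 0 ≤ f (A : Matrix _ _ ℝ)} :=
      isClosed_le continuous_const (f.continuous.comp continuous_subtype_val)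
    have hsub : (ρ.range : Set (Matrix.orthogonalGroup (Fin d) ℝ)) ⊆
        {A | 0 ≤ f (A : Matrix _ _ ℝ)} := by
      rintro _ ⟨g, rfl⟩
      exact hf g
    exact closure_minimal hsub hclosed g.2
  · have hmem : ρ h ∈ G := Subgroup.le_topologicalClosure _ ⟨h, rfl⟩
    change ∫ g, f' (ev g) ∂μ = ∫ g, f (ev g) ∂μ
    rw [← integral_mul_left_eq_self (μ := μ) (fun g => f (ev g)) ⟨ρ h, hmem⟩]
    exact integral_congr_ae (Filter.Eventually.of_forall fun g => hff' _)

variable {ρ}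

namespace InvariantMean

variable (m : InvariantMean ρ)

theorem le_mean {f : C(Matrix (Fin d) (Fin d) ℝ, ℝ)} {s : ℝ} (h : ∀ g, s ≤ f (ρ g)) :
    s ≤ m.mean f := by
  have h1 := m.nonneg (f - s • 1) fun g => by simpa using h g
  rw [map_sub, map_smul, m.mean_one] at h1
  simpa using h1

theorem mean_eq {f : C(Matrix (Fin d) (Fin d) ℝ, ℝ)} {s : ℝ} (h : ∀ g, f (ρ g) = s) :
    m.mean f = s := by
  have h1 := m.le_mean (f := f) fun g => (h g).ge
  have h2 := m.le_mean (f := -f) (s := -s) fun g => by simp [h g]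
  rw [map_neg] at h2
  linarith

end InvariantMean

/-- The entries of `A M Aᵀ` as continuous functions of `A`. -/
def conjEntry (M : Matrix (Fin d) (Fin d) ℝ) (k l : Fin d) : C(Matrix (Fin d) (Fin d) ℝ, ℝ) :=
  ⟨fun A => (A * M * A.transpose) k l,
    (((continuous_id.matrix_mul continuous_const).matrix_mul
      continuous_id.matrix_transpose).matrix_elem k l)⟩

@[simp]
theorem conjEntry_apply (M A : Matrix (Fin d) (Fin d) ℝ) (k l : Fin d) :
    conjEntry M k l A = (A * M * A.transpose) k l := rfl

theorem orthogonal_transpose_mul (A : Matrix.orthogonalGroup (Fin d) ℝ) :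
    (A : Matrix (Fin d) (Fin d) ℝ).transpose * (A : Matrix (Fin d) (Fin d) ℝ) = 1 :=
  (Matrix.mem_orthogonalGroup_iff' (Fin d) ℝ).1 A.2

theorem trace_conj (A : Matrix.orthogonalGroup (Fin d) ℝ) (M : Matrix (Fin d) (Fin d) ℝ) :
    (A * M * (A : Matrix (Fin d) (Fin d) ℝ).transpose).trace = M.trace := by
  rw [Matrix.trace_mul_comm, ← mul_assoc, orthogonal_transpose_mul, one_mul]

theorem conj_mul_conj (A : Matrix.orthogonalGroup (Fin d) ℝ) (M N : Matrix (Fin d) (Fin d) ℝ) :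
    (A * M * (A : Matrix (Fin d) (Fin d) ℝ).transpose) *
      (A * N * (A : Matrix (Fin d) (Fin d) ℝ).transpose) =
      A * (M * N) * (A : Matrix (Fin d) (Fin d) ℝ).transpose := by
  calc _ = A * M * ((A : Matrix (Fin d) (Fin d) ℝ).transpose * A) * N *
      (A : Matrix (Fin d) (Fin d) ℝ).transpose := by simp only [mul_assoc]
    _ = _ := by rw [orthogonal_transpose_mul]; simp only [mul_assoc, one_mul]

/-- Irreducibility, in the form of Schur's lemma for symmetric matrices. -/
def FixesOnlyScalars (ρ : Γ →* Matrix.orthogonalGroup (Fin d) ℝ) : Prop :=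
  ∀ P : Matrix (Fin d) (Fin d) ℝ, P.transpose = P →
    (∀ g, (ρ g : Matrix (Fin d) (Fin d) ℝ) * P * (ρ g : Matrix (Fin d) (Fin d) ℝ).transpose = P) →
    ∃ c : ℝ, P = c • (1 : Matrix (Fin d) (Fin d) ℝ)

theorem mean_conjEntry [Nonempty (Fin d)] (hρ : FixesOnlyScalars ρ) (m : InvariantMean ρ)
    {M : Matrix (Fin d) (Fin d) ℝ} (hM : M.transpose = M) (k l : Fin d) :
    m.mean (conjEntry M k l) = if k = l then M.trace / d else 0 := by
  set P : Matrix (Fin d) (Fin d) ℝ := Matrix.of fun k l => m.mean (conjEntry M k l) with hP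
  have hPe : ∀ k l, P k l = m.mean (conjEntry M k l) := fun _ _ => rfl
  have hsymm : P.transpose = P := by
    ext k l
    rw [Matrix.transpose_apply, hPe, hPe]
    refine congrArg m.mean (ContinuousMap.ext fun A => ?_)
    rw [conjEntry_apply, conjEntry_apply, ← Matrix.transpose_apply (A * M * A.transpose)]
    simp only [Matrix.transpose_mul, Matrix.transpose_transpose, hM, mul_assoc]
  obtain ⟨c, hc⟩ := hρ P hsymm fun h => by
    ext k l
    have h1 := m.invariant h (conjEntry M k l)
      (∑ b, ∑ a, ((ρ h : Matrix (Fin d) (Fin d) ℝ) k a * (ρ h : Matrix (Fin d) (Fin d) ℝ) l b) •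
        conjEntry M a b) fun A => by
      have h2 : (ρ h * A) * M * ((ρ h : Matrix (Fin d) (Fin d) ℝ) * A).transpose =
          ρ h * (A * M * A.transpose) * (ρ h : Matrix (Fin d) (Fin d) ℝ).transpose := by
        rw [Matrix.transpose_mul]
        simp only [mul_assoc]
      rw [conjEntry_apply, h2, Matrix.mul_apply]
      simp only [ContinuousMap.sum_apply, ContinuousMap.smul_apply, conjEntry_apply, smul_eq_mul,
        Matrix.transpose_apply]
      refine Finset.sum_congr rfl fun b _ => ?_
      rw [Matrix.mul_apply, Finset.sum_mul]
      exact Finset.sum_congr rfl fun a _ => by ring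
    rw [hPe, ← h1, Matrix.mul_apply, map_sum]
    refine Finset.sum_congr rfl fun b _ => ?_
    rw [Matrix.mul_apply, Finset.sum_mul, map_sum]
    refine Finset.sum_congr rfl fun a _ => ?_
    rw [map_smul, smul_eq_mul, Matrix.transpose_apply, hPe]
    ring
  have htr : P.trace = M.trace := by
    have h1 : P.trace = m.mean (∑ k, conjEntry M k k) := by
      rw [map_sum]
      rfl
    rw [h1]
    refine m.mean_eq fun g => ?_
    rw [← trace_conj (ρ g) M]
    simp [Matrix.trace]
  have hd : (d : ℝ) ≠ 0 := by
    have := Fin.pos_iff_nonempty.2 ‹_›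
    positivity
  have hcd : c = M.trace / d := by
    rw [hc, Matrix.trace_smul, Matrix.trace_one, Fintype.card_fin, smul_eq_mul] at htr
    rw [← htr]
    field_simp
  change P k l = _
  rw [hc, hcd, Matrix.smul_apply, Matrix.one_apply]
  split_ifs <;> simp

/-- A lower bound for two linear functionals along the orbit passes to the averages. -/
theorem le_of_forall_conj [Nonempty (Fin d)] (hρ : FixesOnlyScalars ρ)
    {M₁ M₂ : Matrix (Fin d) (Fin d) ℝ} (h₁ : M₁.transpose = M₁) (h₂ : M₂.transpose = M₂)
    (K G : Fin d → Fin d → ℝ) (s : ℝ)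
    (h : ∀ g, s ≤ (∑ k, ∑ l, ((ρ g : Matrix (Fin d) (Fin d) ℝ) * M₁ *
        (ρ g : Matrix (Fin d) (Fin d) ℝ).transpose) k l * K k l) +
      ∑ k, ∑ l, ((ρ g : Matrix (Fin d) (Fin d) ℝ) * M₂ *
        (ρ g : Matrix (Fin d) (Fin d) ℝ).transpose) k l * G k l) :
    s ≤ M₁.trace / d * ∑ k, K k k + M₂.trace / d * ∑ k, G k k := by
  obtain ⟨m⟩ := nonempty_invariantMean ρ
  have h1 := m.le_mean (f := (∑ k, ∑ l, K k l • conjEntry M₁ k l) +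
    ∑ k, ∑ l, G k l • conjEntry M₂ k l) (s := s) fun g => by
      simpa [mul_comm] using h g
  refine h1.trans (le_of_eq ?_)
  simp [mean_conjEntry hρ m h₁, mean_conjEntry hρ m h₂, Finset.mul_sum, mul_comm]

/-! ### Totally symmetric tensors -/

/-- Invariance of a `4`-tensor under permutations of its arguments. -/
structure IsSymmTensor (S : Fin d → Fin d → Fin d → Fin d → ℝ) : Prop where
  swap₁ : ∀ k l p q, S k l p q = S l k p q
  swap₂ : ∀ k l p q, S k l p q = S k p l q
  swap₃ : ∀ k l p q, S k l p q = S k l q p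

/-- A `4`-tensor as a function of the list of its arguments. -/
def tensorOfList (S : Fin d → Fin d → Fin d → Fin d → ℝ) : List (Fin d) → ℝ
  | [k, l, p, q] => S k l p q
  | _ => 0

theorem IsSymmTensor.tensorOfList_perm {S : Fin d → Fin d → Fin d → Fin d → ℝ}
    (hS : IsSymmTensor S) {L L' : List (Fin d)} (h : L.Perm L') (pre : List (Fin d))
    (hlen : (pre ++ L).length = 4) : tensorOfList S (pre ++ L) = tensorOfList S (pre ++ L') := by
  induction h generalizing pre with
  | nil => rfl
  | cons x _ ih => simpa using ih (pre ++ [x]) (by simpa using hlen)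
  | swap x y L =>
    match pre, L, hlen with
    | [], [p, q], _ => exact hS.swap₁ _ _ _ _
    | [_], [q], _ => exact hS.swap₂ _ _ _ _
    | [_, _], [], _ => exact hS.swap₃ _ _ _ _
    | [], [], h | [], [_], h | [], _ :: _ :: _ :: _, h | [_], [], h | [_], _ :: _ :: _, h
    | [_, _], _ :: _, h | _ :: _ :: _ :: _, _, h =>
      simp at h <;> omega
  | trans h₁ _ ih₁ ih₂ =>
    rw [ih₁ pre hlen, ih₂ pre (by simpa [h₁.length_eq] using hlen)]

/-- The quartic form attached to a `4`-tensor. -/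
def quarticForm (R : Fin d → Fin d → Fin d → Fin d → ℝ) : MvPolynomial (Fin d) ℝ :=
  ∑ k, ∑ l, ∑ p, ∑ q, MvPolynomial.C (R k l p q) * MvPolynomial.X k * MvPolynomial.X l *
    MvPolynomial.X p * MvPolynomial.X q

/-- Contraction with a symmetric tensor depends only on the quartic form. -/
theorem IsSymmTensor.contract_eq {S : Fin d → Fin d → Fin d → Fin d → ℝ} (hS : IsSymmTensor S)
    {R R' : Fin d → Fin d → Fin d → Fin d → ℝ} (h : quarticForm R = quarticForm R') :
    ∑ k, ∑ l, ∑ p, ∑ q, R k l p q * S k l p q = ∑ k, ∑ l, ∑ p, ∑ q, R' k l p q * S k l p q := by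
  let Λ : MvPolynomial (Fin d) ℝ →ₗ[ℝ] ℝ := (MvPolynomial.basisMonomials (Fin d) ℝ).constr ℝ
    fun v => tensorOfList S (Finsupp.toMultiset v).toList
  have hΛ : ∀ R : Fin d → Fin d → Fin d → Fin d → ℝ, Λ (quarticForm R) =
      ∑ k, ∑ l, ∑ p, ∑ q, R k l p q * S k l p q := by
    intro R
    simp only [quarticForm, map_sum]
    refine Finset.sum_congr rfl fun k _ => Finset.sum_congr rfl fun l _ =>
      Finset.sum_congr rfl fun p _ => Finset.sum_congr rfl fun q _ => ?_
    set v : Fin d →₀ ℕ := Finsupp.single k 1 + Finsupp.single l 1 + Finsupp.single p 1 +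
      Finsupp.single q 1 with hv
    have h1 : MvPolynomial.C (R k l p q) * MvPolynomial.X k * MvPolynomial.X l *
        MvPolynomial.X p * MvPolynomial.X q =
        R k l p q • (MvPolynomial.basisMonomials (Fin d) ℝ) v := by
      rw [MvPolynomial.coe_basisMonomials]
      simp only [MvPolynomial.X, MvPolynomial.C_mul_monomial, MvPolynomial.monomial_mul,
        MvPolynomial.smul_monomial, hv, smul_eq_mul, mul_one]
    have h2 : Λ ((MvPolynomial.basisMonomials (Fin d) ℝ) v) =
        tensorOfList S (Finsupp.toMultiset v).toList := Module.Basis.constr_basis _ _ _ _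
    have h3 : (Finsupp.toMultiset v).toList.Perm [k, l, p, q] := by
      rw [← Multiset.coe_eq_coe, Multiset.coe_toList, hv]
      simp only [map_add, Finsupp.toMultiset_single, one_smul]
      rfl
    have h4 := hS.tensorOfList_perm h3 [] (by simp [h3.length_eq])
    simp only [List.nil_append] at h4
    rw [h1, map_smul, h2, h4]
    rfl
  rw [← hΛ, ← hΛ, h]

end Averaging

section Frames

variable {d : ℕ} {Γ : Type*} [Group Γ] {ρ : Γ →* Matrix.orthogonalGroup (Fin d) ℝ}

theorem isHomogeneous_quarticForm (R : Fin d → Fin d → Fin d → Fin d → ℝ) :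
    (quarticForm R).IsHomogeneous 4 := by
  refine MvPolynomial.IsHomogeneous.sum _ _ _ fun k _ => MvPolynomial.IsHomogeneous.sum _ _ _
    fun l _ => MvPolynomial.IsHomogeneous.sum _ _ _ fun p _ =>
      MvPolynomial.IsHomogeneous.sum _ _ _ fun q _ => ?_
  exact ((((MvPolynomial.isHomogeneous_C _ _).mul (MvPolynomial.isHomogeneous_X _ _)).mul
    (MvPolynomial.isHomogeneous_X _ _)).mul (MvPolynomial.isHomogeneous_X _ _)).mul
    (MvPolynomial.isHomogeneous_X _ _)

theorem eval_quarticForm (R : Fin d → Fin d → Fin d → Fin d → ℝ) (x : Fin d → ℝ) :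
    MvPolynomial.eval x (quarticForm R) =
      ∑ k, ∑ l, ∑ p, ∑ q, R k l p q * x k * x l * x p * x q := by
  simp [quarticForm]

theorem quarticForm_delta (c : ℝ) :
    quarticForm (d := d) (fun k l p q => if k = l then if p = q then c else 0 else 0) =
      MvPolynomial.C c * (∑ i, MvPolynomial.X i ^ 2) ^ 2 := by
  rw [sq (∑ i, MvPolynomial.X i ^ 2), Finset.sum_mul_sum, Finset.mul_sum, quarticForm]
  refine Finset.sum_congr rfl fun k _ => ?_
  rw [Finset.sum_eq_single_of_mem k (Finset.mem_univ k), Finset.mul_sum]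
  · refine Finset.sum_congr rfl fun p _ => ?_
    rw [Finset.sum_eq_single_of_mem p (Finset.mem_univ p)]
    · rw [if_pos rfl, if_pos rfl]
      ring
    · intro q _ hq
      rw [if_pos rfl, if_neg hq.symm]
      simp
  · intro l _ hl
    simp [hl.symm]

/-- The symmetrisation of `δ ⊗ δ`. -/
def symmDelta (k l p q : Fin d) : ℝ :=
  (if k = l then if p = q then 1 else 0 else 0) + (if k = p then if l = q then 1 else 0 else 0) +
    (if k = q then if l = p then 1 else 0 else 0)

theorem isSymmTensor_symmDelta : IsSymmTensor (symmDelta (d := d)) := by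
  set e : Fin d → Fin d → ℝ := fun k l => if k = l then 1 else 0
  have hs : ∀ k l, e k l = e l k := fun k l => if_congr eq_comm rfl rfl
  have h : ∀ k l p q, symmDelta k l p q = e k l * e p q + e k p * e l q + e k q * e l p := by
    intro k l p q
    simp only [symmDelta, e, ite_mul, one_mul, zero_mul]
  refine ⟨fun k l p q => ?_, fun k l p q => ?_, fun k l p q => ?_⟩ <;> rw [h, h]
  · rw [hs k l]
    ring
  · rw [hs p l]
    ring
  · rw [hs q p]
    ring

theorem contract_symmDelta (N : Matrix (Fin d) (Fin d) ℝ) (hN : N.transpose = N) :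
    ∑ k, ∑ l, ∑ p, ∑ q, N k l * N p q * symmDelta k l p q =
      N.trace ^ 2 + 2 * (N * N).trace := by
  have hs : ∀ k l, N k l = N l k := fun k l => congrFun (congrFun hN.symm k) l
  simp only [symmDelta, mul_add, Finset.sum_add_distrib, mul_ite, mul_one, mul_zero,
    Finset.sum_ite_irrel, Finset.sum_const_zero, Finset.sum_ite_eq, Finset.mem_univ, if_true]
  have h1 : N.trace ^ 2 = ∑ k, ∑ p, N k k * N p p := by
    rw [sq, Matrix.trace, Finset.sum_mul_sum]
    rfl
  have h2 : (N * N).trace = ∑ k, ∑ l, N k l * N k l := by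
    simp only [Matrix.trace, Matrix.diag_apply, Matrix.mul_apply]
    exact Finset.sum_congr rfl fun k _ => Finset.sum_congr rfl fun l _ => by rw [hs l k]
  have h3 : ∑ k, ∑ l, N k l * N l k = ∑ k, ∑ l, N k l * N k l :=
    Finset.sum_congr rfl fun k _ => Finset.sum_congr rfl fun l _ => by rw [hs l k]
  rw [h1, h2, h3]
  ring

theorem transpose_conj {M : Matrix (Fin d) (Fin d) ℝ} (hM : M.transpose = M)
    (A : Matrix (Fin d) (Fin d) ℝ) : (A * M * A.transpose).transpose = A * M * A.transpose := by
  simp only [Matrix.transpose_mul, Matrix.transpose_transpose, hM, mul_assoc]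

/-- The case of a group whose only invariant quartic forms are the multiples of `|x|⁴`. -/
theorem le_of_forall_conj_quartic [Nonempty (Fin d)] (hρ : FixesOnlyScalars ρ)
    (hfr : ∀ P : MvPolynomial (Fin d) ℝ, P.IsHomogeneous 4 →
      (∀ g x, MvPolynomial.eval ((ρ g : Matrix (Fin d) (Fin d) ℝ).mulVec x) P =
        MvPolynomial.eval x P) →
      ∃ c : ℝ, P = MvPolynomial.C c * (∑ i, MvPolynomial.X i ^ 2) ^ 2)
    {M : Matrix (Fin d) (Fin d) ℝ} (hM : M.transpose = M)
    {S : Fin d → Fin d → Fin d → Fin d → ℝ} (hS : IsSymmTensor S)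
    (G : Fin d → Fin d → ℝ) (s : ℝ)
    (h : ∀ g, s ≤ (∑ k, ∑ l, ∑ p, ∑ q, ((ρ g : Matrix (Fin d) (Fin d) ℝ) * M *
        (ρ g : Matrix (Fin d) (Fin d) ℝ).transpose) k l * ((ρ g : Matrix (Fin d) (Fin d) ℝ) * M *
        (ρ g : Matrix (Fin d) (Fin d) ℝ).transpose) p q * S k l p q) +
      ∑ k, ∑ l, ((ρ g : Matrix (Fin d) (Fin d) ℝ) * M *
        (ρ g : Matrix (Fin d) (Fin d) ℝ).transpose) k l * G k l) :
    s ≤ (M.trace ^ 2 + 2 * (M * M).trace) / (d * (d + 2)) * ∑ k, ∑ p, S k k p p +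
      M.trace / d * ∑ k, G k k := by
  obtain ⟨m⟩ := nonempty_invariantMean ρ
  set R : Fin d → Fin d → Fin d → Fin d → ℝ := fun k l p q =>
    m.mean (conjEntry M k l * conjEntry M p q) with hR
  have hmean : ∀ S : Fin d → Fin d → Fin d → Fin d → ℝ,
      ∑ k, ∑ l, ∑ p, ∑ q, R k l p q * S k l p q =
      m.mean (∑ k, ∑ l, ∑ p, ∑ q, S k l p q • (conjEntry M k l * conjEntry M p q)) := by
    intro S
    simp only [map_sum, map_smul, smul_eq_mul, hR]
    exact Finset.sum_congr rfl fun k _ => Finset.sum_congr rfl fun l _ =>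
      Finset.sum_congr rfl fun p _ => Finset.sum_congr rfl fun q _ => mul_comm _ _
  have hquad : ∀ (x : Fin d → ℝ) (A : Matrix (Fin d) (Fin d) ℝ),
      (∑ k, ∑ l, ∑ p, ∑ q, (x k * x l * x p * x q) • (conjEntry M k l * conjEntry M p q)) A =
      (x ⬝ᵥ (A * M * A.transpose).mulVec x) ^ 2 := by
    intro x A
    have h1 : x ⬝ᵥ (A * M * A.transpose).mulVec x =
        ∑ k, ∑ l, x k * x l * (A * M * A.transpose) k l := by
      simp only [dotProduct, Matrix.mulVec, Finset.mul_sum]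
      exact Finset.sum_congr rfl fun k _ => Finset.sum_congr rfl fun l _ => by ring
    rw [h1, sq]
    simp only [ContinuousMap.sum_apply, ContinuousMap.smul_apply, ContinuousMap.mul_apply,
      conjEntry_apply, smul_eq_mul, Finset.sum_mul, Finset.mul_sum]
    refine Finset.sum_congr rfl fun k _ => Finset.sum_congr rfl fun l _ =>
      Finset.sum_congr rfl fun p _ => Finset.sum_congr rfl fun q _ => by ring
  have heval : ∀ x : Fin d → ℝ, MvPolynomial.eval x (quarticForm R) = m.mean
      (∑ k, ∑ l, ∑ p, ∑ q, (x k * x l * x p * x q) • (conjEntry M k l * conjEntry M p q)) := by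
    intro x
    rw [eval_quarticForm, ← hmean]
    exact Finset.sum_congr rfl fun k _ => Finset.sum_congr rfl fun l _ =>
      Finset.sum_congr rfl fun p _ => Finset.sum_congr rfl fun q _ => by ring
  obtain ⟨c, hc⟩ := hfr (quarticForm R) (isHomogeneous_quarticForm R) fun g x => by
    rw [heval, heval]
    refine m.invariant g⁻¹ _ _ fun A => ?_
    rw [hquad, hquad]
    have hinv : ((ρ g⁻¹ : Matrix.orthogonalGroup (Fin d) ℝ) : Matrix (Fin d) (Fin d) ℝ) =
        (ρ g : Matrix (Fin d) (Fin d) ℝ).transpose := by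
      rw [map_inv]
      rfl
    rw [hinv, Matrix.transpose_mul, Matrix.transpose_transpose]
    have hassoc : (ρ g : Matrix (Fin d) (Fin d) ℝ).transpose * A * M *
        (A.transpose * (ρ g : Matrix (Fin d) (Fin d) ℝ)) =
        (ρ g : Matrix (Fin d) (Fin d) ℝ).transpose * ((A * M * A.transpose) * ρ g) := by
      simp only [mul_assoc]
    have hgen : ∀ B C : Matrix (Fin d) (Fin d) ℝ, x ⬝ᵥ (C.transpose * (B * C)).mulVec x =
        C.mulVec x ⬝ᵥ B.mulVec (C.mulVec x) := by
      intro B C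
      rw [← Matrix.mulVec_mulVec, ← Matrix.mulVec_mulVec, Matrix.dotProduct_mulVec x,
        Matrix.vecMul_transpose]
    rw [hassoc, hgen]
  rw [← quarticForm_delta] at hc
  have hdelta : ∀ S : Fin d → Fin d → Fin d → Fin d → ℝ,
      ∑ k, ∑ l, ∑ p, ∑ q, (if k = l then if p = q then c else 0 else 0) * S k l p q =
      c * ∑ k, ∑ p, S k k p p := by
    intro S
    simp [ite_mul, Finset.sum_ite_irrel, Finset.mul_sum]
  have hd : (0 : ℝ) < d := Nat.cast_pos.2 (Fin.pos_iff_nonempty.2 ‹_›)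
  have hcval : c = (M.trace ^ 2 + 2 * (M * M).trace) / (d * (d + 2)) := by
    have h1 := isSymmTensor_symmDelta.contract_eq hc
    rw [hdelta, hmean, m.mean_eq (s := M.trace ^ 2 + 2 * (M * M).trace)] at h1
    · have h2 : ∑ k : Fin d, ∑ p : Fin d, symmDelta k k p p = d * (d + 2) := by
        have : ∀ k p : Fin d, symmDelta k k p p = 1 + 2 * (if k = p then 1 else 0) := by
          intro k p
          by_cases hkp : k = p
          · simp [symmDelta, hkp]
            norm_num
          · simp [symmDelta, hkp]
        simp [this, Finset.sum_add_distrib]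
        ring
      rw [h2] at h1
      rw [h1]
      field_simp
    · intro g
      have h2 := contract_symmDelta _ (transpose_conj hM (ρ g : Matrix (Fin d) (Fin d) ℝ))
      rw [trace_conj, conj_mul_conj, trace_conj] at h2
      rw [← h2]
      simp [mul_comm]
  have h1 := m.le_mean (f := (∑ k, ∑ l, ∑ p, ∑ q, S k l p q • (conjEntry M k l * conjEntry M p q)) +
    ∑ k, ∑ l, G k l • conjEntry M k l) (s := s) fun g => by
      refine (h g).trans (le_of_eq ?_)
      simp [mul_comm]
  refine h1.trans (le_of_eq ?_)
  rw [map_add, ← hmean, hS.contract_eq hc, hdelta, hcval]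
  simp [mean_conjEntry hρ m hM, Finset.mul_sum, mul_comm]

end Frames

/-! ### Singular values -/

section Schatten

variable {d : ℕ} (A : EuclideanSpace ℝ (Fin d) →ₗ[ℝ] EuclideanSpace ℝ (Fin d))

theorem stdMatrix_mul (A B : EuclideanSpace ℝ (Fin d) →ₗ[ℝ] EuclideanSpace ℝ (Fin d)) :
    stdMatrix (A * B) = stdMatrix A * stdMatrix B := LinearMap.toMatrix_mul _ _ _

theorem stdMatrix_adjoint : stdMatrix (LinearMap.adjoint A) = (stdMatrix A).transpose := by
  rw [stdMatrix, LinearMap.toMatrix_adjoint]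
  rfl

theorem trace_stdMatrix : (stdMatrix A).trace = LinearMap.trace ℝ _ A :=
  (LinearMap.trace_eq_matrix_trace ℝ _ A).symm

theorem schattenPow_two_mul (p : ℕ) : schattenPow (2 * p) A =
    ∑ i, A.isSymmetric_adjoint_comp_self.eigenvalues finrank_euclideanSpace_fin i ^ p := by
  rw [schattenPow, ← Fin.sum_univ_eq_sum_range (fun i => A.singularValues i ^ (2 * p))]
  refine Finset.sum_congr rfl fun i _ => ?_
  rw [pow_mul, A.sq_singularValues_fin finrank_euclideanSpace_fin]

theorem schattenPow_two : schattenPow 2 A = (stdMatrix A * (stdMatrix A).transpose).trace := by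
  have h := schattenPow_two_mul A 1
  rw [mul_one] at h
  rw [h, Matrix.trace_mul_comm, ← stdMatrix_adjoint, ← stdMatrix_mul, trace_stdMatrix]
  have := A.isSymmetric_adjoint_comp_self.trace_eq_sum_eigenvalues finrank_euclideanSpace_fin
  simp only [pow_one]
  exact this.symm

theorem schattenPow_four : schattenPow 4 A = ((stdMatrix A * (stdMatrix A).transpose) *
    (stdMatrix A * (stdMatrix A).transpose)).trace := by
  have hs := A.isSymmetric_adjoint_comp_self
  have h := schattenPow_two_mul A 2
  have e : ((stdMatrix A * (stdMatrix A).transpose) *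
      (stdMatrix A * (stdMatrix A).transpose)).trace =
      (stdMatrix ((LinearMap.adjoint A ∘ₗ A) * (LinearMap.adjoint A ∘ₗ A))).trace := by
    rw [stdMatrix_mul, ← Module.End.mul_eq_comp, stdMatrix_mul, stdMatrix_adjoint, mul_assoc,
      Matrix.trace_mul_comm]
    simp only [mul_assoc]
  rw [e, trace_stdMatrix, show 4 = 2 * 2 from rfl, h, LinearMap.trace_eq_sum_inner _
    (hs.eigenvectorBasis finrank_euclideanSpace_fin)]
  refine Finset.sum_congr rfl fun i _ => ?_
  rw [Module.End.mul_apply, hs.apply_eigenvectorBasis, map_smul, hs.apply_eigenvectorBasis,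
    inner_smul_right, inner_smul_right, real_inner_self_eq_norm_sq, OrthonormalBasis.norm_eq_one]
  simp [sq]

theorem sq_schattenPow_two_le : schattenPow 2 A ^ 2 ≤ d * schattenPow 4 A := by
  have h := sq_sum_le_card_mul_sum_sq (s := Finset.range d) (f := fun i => A.singularValues i ^ 2)
  simpa [schattenPow, ← pow_mul] using h

theorem constD_le_constC : constD A ≤ constC A := by
  rw [constD, constC, div_le_iff₀ (by positivity)]
  linarith [sq_schattenPow_two_le A]

theorem schattenPow_two_pos [Nonempty (Fin d)]
    (S : EuclideanSpace ℝ (Fin d) ≃ₗ[ℝ] EuclideanSpace ℝ (Fin d)) :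
    0 < schattenPow 2 S.toLinearMap := by
  refine Finset.sum_pos (fun i hi => pow_pos ?_ 2)
    (Finset.nonempty_range_iff.2 (Fin.pos_iff_nonempty.2 ‹_›).ne')
  exact (S.toLinearMap.injective_iff_forall_lt_finrank_singularValues_pos.1 S.injective) i
    (by simpa using hi)

end Schatten

/-! ### The symmetry group as a group of orthogonal matrices -/

section Symmetries

variable {d : ℕ} {Ω : Set (EuclideanSpace ℝ (Fin d))}

theorem stdMatrix_mulVec (A : EuclideanSpace ℝ (Fin d) →ₗ[ℝ] EuclideanSpace ℝ (Fin d))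
    (x : EuclideanSpace ℝ (Fin d)) : (stdMatrix A).mulVec (fun i => x i) = fun i => A x i :=
  LinearMap.toMatrix_mulVec_repr (EuclideanSpace.basisFun (Fin d) ℝ).toBasis
    (EuclideanSpace.basisFun (Fin d) ℝ).toBasis A x

theorem transpose_stdMatrix_mul_isometry
    (O : EuclideanSpace ℝ (Fin d) ≃ₗᵢ[ℝ] EuclideanSpace ℝ (Fin d)) :
    (stdMatrix (O.toLinearEquiv : EuclideanSpace ℝ (Fin d) →ₗ[ℝ] _)).transpose *
      stdMatrix (O.toLinearEquiv : EuclideanSpace ℝ (Fin d) →ₗ[ℝ] _) = 1 := by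
  ext i j
  have h := O.inner_map_map (EuclideanSpace.single i (1 : ℝ)) (EuclideanSpace.single j (1 : ℝ))
  rw [PiLp.inner_apply, EuclideanSpace.inner_single_left] at h
  simp only [Matrix.mul_apply, Matrix.transpose_apply, stdMatrix_apply, Matrix.one_apply]
  simpa [mul_comm, Pi.single_apply, eq_comm] using h

/-- The orthogonal parts of the isometries of `Ω`, as matrices. -/
def isometryMatrix (Ω : Set (EuclideanSpace ℝ (Fin d))) :
    isometryGroup Ω →* Matrix.orthogonalGroup (Fin d) ℝ where
  toFun g := ⟨stdMatrix (isometryRep Ω g), (Matrix.mem_orthogonalGroup_iff' (Fin d) ℝ).2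
    (transpose_stdMatrix_mul_isometry g.1.linearIsometryEquiv)⟩
  map_one' := by
    apply Subtype.ext
    simp only [map_one]
    exact LinearMap.toMatrix_one _
  map_mul' g h := by
    apply Subtype.ext
    simp only [map_mul]
    exact stdMatrix_mul _ _

theorem coe_isometryMatrix (g : isometryGroup Ω) :
    (isometryMatrix Ω g : Matrix (Fin d) (Fin d) ℝ) = stdMatrix (isometryRep Ω g) := rfl

theorem stdMatrix_injective : Function.Injective (stdMatrix (d := d)) :=
  (LinearMap.toMatrix _ _).injective

theorem fixesOnlyScalars_isometryMatrix [Nonempty (Fin d)]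
    (hirr : (isometryRep Ω).IsIrreducible) : FixesOnlyScalars (isometryMatrix Ω) := by
  intro P hP hfix
  set f := Matrix.toLin (EuclideanSpace.basisFun (Fin d) ℝ).toBasis
    (EuclideanSpace.basisFun (Fin d) ℝ).toBasis P with hf
  have hfP : stdMatrix f = P := LinearMap.toMatrix_toLin _ _ P
  have hadj : LinearMap.adjoint f = f := by
    apply stdMatrix_injective
    rw [stdMatrix_adjoint, hfP, hP]
  have hsymm : f.IsSymmetric := fun x y => by
    conv_lhs => rw [← hadj]
    exact LinearMap.adjoint_inner_left f y x
  have hcomm : ∀ g, f * isometryRep Ω g = isometryRep Ω g * f := by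
    intro g
    apply stdMatrix_injective
    rw [stdMatrix_mul, stdMatrix_mul, hfP]
    have h1 := hfix g
    have h2 := orthogonal_transpose_mul (isometryMatrix Ω g)
    rw [coe_isometryMatrix] at h1 h2
    conv_lhs => rw [← h1, mul_assoc, h2, mul_one]
  set μ := hsymm.eigenvalues finrank_euclideanSpace_fin (Classical.arbitrary (Fin d)) with hμ
  have hev : Module.End.HasEigenvalue f μ :=
    hsymm.hasEigenvalue_eigenvalues finrank_euclideanSpace_fin _
  let W : Subrepresentation (isometryRep Ω) :=
    ⟨Module.End.eigenspace f μ, fun g v hv => by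
      rw [Module.End.mem_eigenspace_iff] at hv ⊢
      have := LinearMap.congr_fun (hcomm g) v
      rw [Module.End.mul_apply, Module.End.mul_apply, hv, map_smul] at this
      exact this⟩
  have hW : W = ⊤ := by
    rcases hirr.eq_bot_or_eq_top W with h | h
    · exact absurd (congrArg Subrepresentation.toSubmodule h) hev
    · exact h
  refine ⟨μ, ?_⟩
  have hf1 : f = μ • (1 : Module.End ℝ (EuclideanSpace ℝ (Fin d))) := by
    ext1 v
    have hv : v ∈ W.toSubmodule := by
      rw [hW]
      trivial
    exact Module.End.mem_eigenspace_iff.1 hv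
  rw [← hfP, hf1, stdMatrix, map_smul, LinearMap.toMatrix_one]

end Symmetries

/-! ### Comparison of eigenvalue sums -/

section Comparison

variable {d : ℕ} {Ω : Set (EuclideanSpace ℝ (Fin d))}

theorem plateForm_self_eq (τ : ℝ) (U : Jet d) : plateForm τ U U =
    ∑ k, ∑ p, inner ℝ (U.2.2 k k) (U.2.2 p p) + τ * ∑ k, inner ℝ (U.2.1 k) (U.2.1 k) := by
  simp only [plateForm, sum_inner, inner_sum]
  congr 1
  exact Finset.sum_comm

theorem anisoForm_smul_one (τ q : ℝ) (U : Jet d) :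
    anisoForm (q * τ) (q • (1 : Matrix (Fin d) (Fin d) ℝ)) U = q ^ 2 * plateForm τ U U := by
  rw [plateForm_self_eq, anisoForm]
  simp only [Matrix.smul_apply, Matrix.one_apply, smul_eq_mul, mul_ite, mul_one, mul_zero, ite_mul,
    zero_mul, Finset.sum_ite_eq, Finset.mem_univ, if_true, Finset.sum_const_zero,
    Finset.sum_ite_irrel, mul_add, Finset.mul_sum]
  congr 1
  · exact Finset.sum_congr rfl fun k _ => Finset.sum_congr rfl fun p _ => by ring
  · exact Finset.sum_congr rfl fun k _ => by ring

theorem H20.inner_hess_hess' {U : Jet d} (hU : U ∈ H20 Ω) (k l p q : Fin d) :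
    inner ℝ (U.2.2 k l) (U.2.2 p q) = inner ℝ (U.2.2 k p) (U.2.2 l q) := by
  rw [H20.hess_symm hU k l, H20.inner_hess_hess hU, H20.hess_symm hU p k]

theorem isSymmTensor_inner_hess {n : ℕ} (u : ℕ → H20 Ω) : IsSymmTensor fun k l p q =>
    ∑ j ∈ Finset.range n, inner ℝ ((u j : Jet d).2.2 k l) ((u j : Jet d).2.2 p q) := by
  refine ⟨fun k l p q => ?_, fun k l p q => ?_, fun k l p q => ?_⟩ <;>
    refine Finset.sum_congr rfl fun j _ => ?_
  · rw [H20.hess_symm (u j).2 k l]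
  · exact H20.inner_hess_hess' (u j).2 k l p q
  · rw [H20.hess_symm (u j).2 p q]

theorem sum_rotate₄ {κ : Type*} [Fintype κ] (f : κ → κ → κ → κ → ℝ) :
    ∑ k, ∑ l, ∑ m, ∑ x, f k l m x = ∑ x, ∑ m, ∑ k, ∑ l, f k l m x :=
  calc ∑ k, ∑ l, ∑ m, ∑ x, f k l m x
      = ∑ k, ∑ l, ∑ x, ∑ m, f k l m x :=
        Finset.sum_congr rfl fun _ _ => Finset.sum_congr rfl fun _ _ => Finset.sum_comm
    _ = ∑ k, ∑ x, ∑ l, ∑ m, f k l m x := Finset.sum_congr rfl fun _ _ => Finset.sum_comm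
    _ = ∑ x, ∑ k, ∑ l, ∑ m, f k l m x := Finset.sum_comm
    _ = ∑ x, ∑ k, ∑ m, ∑ l, f k l m x :=
        Finset.sum_congr rfl fun _ _ => Finset.sum_congr rfl fun _ _ => Finset.sum_comm
    _ = ∑ x, ∑ m, ∑ k, ∑ l, f k l m x := Finset.sum_congr rfl fun _ _ => Finset.sum_comm

theorem anisoForm_le {U : Jet d} (hU : U ∈ H20 Ω) (τ : ℝ) {N : Matrix (Fin d) (Fin d) ℝ}
    (hN : N.transpose = N) :
    anisoForm τ N U ≤ ∑ k, ∑ l, (N * N) k l * ∑ m, inner ℝ (U.2.2 k m) (U.2.2 l m) +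
      τ * ∑ k, ∑ l, N k l * inner ℝ (U.2.1 k) (U.2.1 l) := by
  have hs : ∀ k l, N k l = N l k := fun k l => congrFun (congrFun hN.symm k) l
  rw [anisoForm]
  refine add_le_add_left ?_ _
  set W : Fin d → Fin d → L2 d := fun k m => ∑ l, N k l • U.2.2 l m with hW
  have h1 : ∑ k, ∑ l, ∑ m, ∑ p, N k l * N m p * inner ℝ (U.2.2 k l) (U.2.2 m p) =
      ∑ k, ∑ m, inner ℝ (W k m) (W m k) := by
    refine Finset.sum_congr rfl fun k _ => ?_
    rw [Finset.sum_comm]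
    refine Finset.sum_congr rfl fun m _ => ?_
    simp only [hW, sum_inner, inner_sum, inner_smul_left, inner_smul_right, RCLike.conj_to_real,
      Finset.mul_sum]
    rw [Finset.sum_comm]
    refine Finset.sum_congr rfl fun p _ => Finset.sum_congr rfl fun l _ => ?_
    rw [H20.hess_symm hU k l, H20.inner_hess_hess' hU, H20.hess_symm hU k p]
    ring
  have h2 : ∑ k, ∑ l, (N * N) k l * ∑ m, inner ℝ (U.2.2 k m) (U.2.2 l m) =
      ∑ k, ∑ m, ‖W k m‖ ^ 2 := by
    simp only [← real_inner_self_eq_norm_sq, hW, sum_inner, inner_sum, inner_smul_left,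
      inner_smul_right, RCLike.conj_to_real, Matrix.mul_apply, Finset.sum_mul, Finset.mul_sum]
    rw [sum_rotate₄]
    refine Finset.sum_congr rfl fun x _ => Finset.sum_congr rfl fun m _ =>
      Finset.sum_congr rfl fun k _ => Finset.sum_congr rfl fun l _ => ?_
    rw [hs k x, real_inner_comm]
    ring
  rw [h1, h2]
  have h3 : ∀ k m, inner ℝ (W k m) (W m k) ≤ (‖W k m‖ ^ 2 + ‖W m k‖ ^ 2) / 2 := fun k m => by
    have := real_inner_le_norm (W k m) (W m k)
    nlinarith [sq_nonneg (‖W k m‖ - ‖W m k‖)]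
  refine (Finset.sum_le_sum fun k _ => Finset.sum_le_sum fun m _ => h3 k m).trans (le_of_eq ?_)
  simp only [add_div, Finset.sum_add_distrib]
  rw [Finset.sum_comm (f := fun k m => ‖W m k‖ ^ 2 / 2)]
  simp only [← Finset.sum_div]
  ring

theorem plateSum_similarity_le [Nonempty (Fin d)] (ho : IsOpen Ω) (hne : Ω.Nonempty)
    (hb : Bornology.IsBounded Ω) (L : EuclideanSpace ℝ (Fin d) ≃ₗ[ℝ] EuclideanSpace ℝ (Fin d))
    (hbL : Bornology.IsBounded (L.symm '' Ω)) {q : ℝ}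
    (hL : stdMatrix L.toLinearMap * (stdMatrix L.toLinearMap).transpose =
      q • (1 : Matrix (Fin d) (Fin d) ℝ)) (τ : ℝ) (n : ℕ) :
    plateSum (L.symm '' Ω) (q * τ) n ≤ q ^ 2 * plateSum Ω τ n := by
  obtain ⟨u, γ, h⟩ := (isCompactForm_plateBilin ho hne hb τ).exists_isLowestEigenvectors n
  have hset : L.symm '' Ω = affineHomeo L 0 ⁻¹' Ω := by
    rw [LinearEquiv.image_symm_eq_preimage]
    ext x
    simp
  rw [hset] at hbL ⊢
  refine (plateSum_preimage_le L 0 ho hne hbL h (q * τ)).trans (le_of_eq ?_)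
  rw [plateSum_eq h, Finset.mul_sum, hL]
  refine Finset.sum_congr rfl fun j hj => ?_
  rw [anisoForm_smul_one, ← h.form_self (Finset.mem_range.1 hj), plateBilin_apply]

theorem isBounded_image_linearEquiv (hb : Bornology.IsBounded Ω)
    (T : EuclideanSpace ℝ (Fin d) ≃ₗ[ℝ] EuclideanSpace ℝ (Fin d)) :
    Bornology.IsBounded (T '' Ω) :=
  T.toContinuousLinearEquiv.lipschitz.isBounded_image hb

/-- The family of inequalities obtained by transplanting eigenfunctions of `Ω` to `T(Ω)` after
composition with an isometry of `Ω`. -/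
theorem plateSum_image_le [Nonempty (Fin d)] (ho : IsOpen Ω) (hne : Ω.Nonempty)
    (hb : Bornology.IsBounded Ω) (T : EuclideanSpace ℝ (Fin d) ≃ₗ[ℝ] EuclideanSpace ℝ (Fin d))
    {a : LinearMap.BilinForm ℝ (H20 Ω)} {n : ℕ} {u : ℕ → H20 Ω} {γ : ℕ → ℝ}
    (h : IsLowestEigenvectors a (H20.toL2 Ω) n u γ) (τ : ℝ) (g : isometryGroup Ω) :
    plateSum (T '' Ω) τ n ≤ ∑ j ∈ Finset.range n, anisoForm τ
      ((isometryMatrix Ω g : Matrix (Fin d) (Fin d) ℝ) *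
        (stdMatrix T.symm.toLinearMap * (stdMatrix T.symm.toLinearMap).transpose) *
        (isometryMatrix Ω g : Matrix (Fin d) (Fin d) ℝ).transpose) (u j : Jet d) := by
  set L := T.symm.trans g.1.linearIsometryEquiv.toLinearEquiv with hL
  set c := g.1 0 with hc
  have hg : g.1 '' Ω = Ω := g.2
  have haff : ∀ x, affineHomeo L c x = g.1 (T.symm x) := by
    intro x
    have := g.1.map_vadd 0 (T.symm x)
    simp only [vadd_eq_add, add_zero] at this
    rw [this]
    rfl
  have hmem : ∀ y, g.1 y ∈ Ω ↔ y ∈ Ω := fun y =>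
    (Set.ext_iff.1 hg _).symm.trans g.1.injective.mem_set_image
  have hset : T '' Ω = affineHomeo L c ⁻¹' Ω := by
    ext x
    rw [Set.mem_preimage, haff]
    constructor
    · rintro ⟨y, hy, rfl⟩
      rwa [T.symm_apply_apply, hmem]
    · intro hx
      exact ⟨T.symm x, (hmem _).1 hx, T.apply_symm_apply x⟩
  have hbT := isBounded_image_linearEquiv hb T
  rw [hset] at hbT ⊢
  have hmat : stdMatrix L.toLinearMap =
      (isometryMatrix Ω g : Matrix (Fin d) (Fin d) ℝ) * stdMatrix T.symm.toLinearMap := by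
    rw [coe_isometryMatrix, ← stdMatrix_mul]
    rfl
  refine (plateSum_preimage_le L c ho hne hbT h τ).trans (le_of_eq ?_)
  rw [hmat, Matrix.transpose_mul]
  simp only [mul_assoc]

theorem stdMatrix_mul_transpose_of_similarity
    {A : EuclideanSpace ℝ (Fin d) →ₗ[ℝ] EuclideanSpace ℝ (Fin d)} {r : ℝ}
    {O : EuclideanSpace ℝ (Fin d) ≃ₗᵢ[ℝ] EuclideanSpace ℝ (Fin d)} (h : ∀ x, A x = r • O x) :
    stdMatrix A * (stdMatrix A).transpose = r ^ 2 • (1 : Matrix (Fin d) (Fin d) ℝ) := by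
  have hA : A = r • (O.toLinearEquiv : EuclideanSpace ℝ (Fin d) →ₗ[ℝ] _) := LinearMap.ext h
  have hO := mul_eq_one_comm.1 (transpose_stdMatrix_mul_isometry O)
  have hs : stdMatrix A = r • stdMatrix (O.toLinearEquiv : EuclideanSpace ℝ (Fin d) →ₗ[ℝ] _) := by
    rw [hA, stdMatrix, map_smul]
    rfl
  rw [hs, Matrix.transpose_smul, Matrix.smul_mul, Matrix.mul_smul, hO, smul_smul, sq]

end Comparison

section Main

variable {d : ℕ} {Ω : Set (EuclideanSpace ℝ (Fin d))}

theorem nonempty_of_isIrreducible (hirr : (isometryRep Ω).IsIrreducible) : Nonempty (Fin d) := by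
  by_contra h
  rw [not_nonempty_iff] at h
  have h1 : (⊥ : Subrepresentation (isometryRep Ω)) = ⊤ :=
    Subrepresentation.toSubmodule_injective (Subsingleton.elim _ _)
  exact bot_ne_top h1

theorem plateSum_eq_energy {τ : ℝ} {n : ℕ} {u : ℕ → H20 Ω} {γ : ℕ → ℝ}
    (h : IsLowestEigenvectors (plateBilin Ω τ) (H20.toL2 Ω) n u γ) :
    plateSum Ω τ n =
      ∑ k, ∑ p, ∑ j ∈ Finset.range n, inner ℝ ((u j : Jet d).2.2 k k) ((u j : Jet d).2.2 p p) +
        τ * ∑ k, ∑ j ∈ Finset.range n, inner ℝ ((u j : Jet d).2.1 k) ((u j : Jet d).2.1 k) := by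
  have h1 : plateSum Ω τ n = ∑ j ∈ Finset.range n, plateForm τ (u j : Jet d) (u j : Jet d) := by
    rw [plateSum_eq h]
    exact Finset.sum_congr rfl fun j hj => (h.form_self (Finset.mem_range.1 hj)).symm
  rw [h1]
  simp only [plateForm_self_eq, Finset.sum_add_distrib, ← Finset.mul_sum]
  rw [Finset.sum_comm (s := Finset.range n), Finset.sum_comm (s := Finset.range n)]
  congr 1
  exact Finset.sum_congr rfl fun k _ => Finset.sum_comm

theorem transpose_mul_transpose_self (A : Matrix (Fin d) (Fin d) ℝ) :
    (A * A.transpose).transpose = A * A.transpose := by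
  rw [Matrix.transpose_mul, Matrix.transpose_transpose]

theorem plateSum_image_le_constC (ho : IsOpen Ω) (hne : Ω.Nonempty) (hb : Bornology.IsBounded Ω)
    (hirr : (isometryRep Ω).IsIrreducible)
    (T : EuclideanSpace ℝ (Fin d) ≃ₗ[ℝ] EuclideanSpace ℝ (Fin d)) (τ : ℝ) (n : ℕ) :
    plateSum (T '' Ω) (τ * constC T.symm.toLinearMap / schattenPow 2 T.symm.toLinearMap) n ≤
      constC T.symm.toLinearMap / d * plateSum Ω τ n := by
  have := nonempty_of_isIrreducible hirr
  obtain ⟨u, γ, h⟩ := (isCompactForm_plateBilin ho hne hb τ).exists_isLowestEigenvectors n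
  set M := stdMatrix T.symm.toLinearMap * (stdMatrix T.symm.toLinearMap).transpose with hM
  have hMt : M.transpose = M := transpose_mul_transpose_self _
  have hpos := schattenPow_two_pos T.symm
  have h2 : schattenPow 2 T.symm.toLinearMap = M.trace := schattenPow_two _
  have h4 : constC T.symm.toLinearMap = (M * M).trace := schattenPow_four _
  set τ' := τ * constC T.symm.toLinearMap / schattenPow 2 T.symm.toLinearMap with hτ'
  have key := le_of_forall_conj (fixesOnlyScalars_isometryMatrix hirr) (M₁ := M * M) (M₂ := M)
    (by rw [Matrix.transpose_mul, hMt]) hMt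
    (fun k l => ∑ m, ∑ j ∈ Finset.range n,
      inner ℝ ((u j : Jet d).2.2 k m) ((u j : Jet d).2.2 l m))
    (fun k l => τ' * ∑ j ∈ Finset.range n, inner ℝ ((u j : Jet d).2.1 k) ((u j : Jet d).2.1 l))
    (plateSum (T '' Ω) τ' n) fun g => by
      refine (plateSum_image_le ho hne hb T h τ' g).trans ?_
      refine (Finset.sum_le_sum fun j _ => anisoForm_le (u j).2 τ' (transpose_conj hMt _)).trans
        (le_of_eq ?_)
      rw [conj_mul_conj, Finset.sum_add_distrib]
      congr 1
      · rw [Finset.sum_comm]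
        refine Finset.sum_congr rfl fun k _ => ?_
        rw [Finset.sum_comm]
        refine Finset.sum_congr rfl fun l _ => ?_
        rw [← Finset.mul_sum, Finset.sum_comm]
      · rw [← Finset.mul_sum, Finset.sum_comm, Finset.mul_sum]
        refine Finset.sum_congr rfl fun k _ => ?_
        rw [Finset.sum_comm, Finset.mul_sum]
        refine Finset.sum_congr rfl fun l _ => ?_
        rw [← Finset.mul_sum]
        ring
  refine key.trans (le_of_eq ?_)
  rw [plateSum_eq_energy h, ← Finset.mul_sum, ← h2, ← h4]
  have h5 : ∑ k, ∑ m, ∑ j ∈ Finset.range n,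
      inner ℝ ((u j : Jet d).2.2 k m) ((u j : Jet d).2.2 k m) =
      ∑ k, ∑ m, ∑ j ∈ Finset.range n,
      inner ℝ ((u j : Jet d).2.2 k k) ((u j : Jet d).2.2 m m) :=
    Finset.sum_congr rfl fun k _ => Finset.sum_congr rfl fun m _ =>
      Finset.sum_congr rfl fun j _ => (H20.inner_hess_hess' (u j).2 k k m m).symm
  rw [h5, hτ']
  field_simp

theorem plateSum_image_le_constD (ho : IsOpen Ω) (hne : Ω.Nonempty) (hb : Bornology.IsBounded Ω)
    (hirr : (isometryRep Ω).IsIrreducible)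
    (T : EuclideanSpace ℝ (Fin d) ≃ₗ[ℝ] EuclideanSpace ℝ (Fin d)) (τ : ℝ) (n : ℕ)
    (hfr : AdmitsFrames 2 Ω) :
    plateSum (T '' Ω) (τ * constD T.symm.toLinearMap / schattenPow 2 T.symm.toLinearMap) n ≤
      constD T.symm.toLinearMap / d * plateSum Ω τ n := by
  have := nonempty_of_isIrreducible hirr
  obtain ⟨u, γ, h⟩ := (isCompactForm_plateBilin ho hne hb τ).exists_isLowestEigenvectors n
  set M := stdMatrix T.symm.toLinearMap * (stdMatrix T.symm.toLinearMap).transpose with hM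
  have hMt : M.transpose = M := transpose_mul_transpose_self _
  have hpos := schattenPow_two_pos T.symm
  have h2 : schattenPow 2 T.symm.toLinearMap = M.trace := schattenPow_two _
  have h4 : schattenPow 4 T.symm.toLinearMap = (M * M).trace := schattenPow_four _
  set τ' := τ * constD T.symm.toLinearMap / schattenPow 2 T.symm.toLinearMap with hτ'
  have key := le_of_forall_conj_quartic (fixesOnlyScalars_isometryMatrix hirr)
    (fun P hP hinv => hfr P hP fun g x => by
      have h1 := hinv g fun i => x i
      rwa [coe_isometryMatrix, stdMatrix_mulVec] at h1) hMt
    (isSymmTensor_inner_hess (n := n) u)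
    (fun k l => τ' * ∑ j ∈ Finset.range n, inner ℝ ((u j : Jet d).2.1 k) ((u j : Jet d).2.1 l))
    (plateSum (T '' Ω) τ' n) fun g => by
      refine (plateSum_image_le ho hne hb T h τ' g).trans (le_of_eq ?_)
      simp only [anisoForm, Finset.sum_add_distrib]
      congr 1
      · rw [Finset.sum_comm]
        refine Finset.sum_congr rfl fun k _ => ?_
        rw [Finset.sum_comm]
        refine Finset.sum_congr rfl fun l _ => ?_
        rw [Finset.sum_comm]
        refine Finset.sum_congr rfl fun p _ => ?_
        rw [Finset.sum_comm]
        exact Finset.sum_congr rfl fun q _ => (Finset.mul_sum _ _ _).symm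
      · rw [← Finset.mul_sum, Finset.sum_comm, Finset.mul_sum]
        refine Finset.sum_congr rfl fun k _ => ?_
        rw [Finset.sum_comm, Finset.mul_sum]
        refine Finset.sum_congr rfl fun l _ => ?_
        rw [← Finset.mul_sum]
        ring
  refine key.trans (le_of_eq ?_)
  have hD : constD T.symm.toLinearMap = (M.trace ^ 2 + 2 * (M * M).trace) / (d + 2) := by
    rw [constD, h2, h4]
  have hc : (M.trace ^ 2 + 2 * (M * M).trace) / (d * ((d : ℝ) + 2)) =
      constD T.symm.toLinearMap / d := by
    rw [hD, div_div, mul_comm (d : ℝ)]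
  rw [plateSum_eq_energy h, ← Finset.mul_sum, hc, ← h2, hτ']
  field_simp

theorem symm_apply_of_similarity
    {T : EuclideanSpace ℝ (Fin d) ≃ₗ[ℝ] EuclideanSpace ℝ (Fin d)} {c : ℝ} (hc : c ≠ 0)
    {O : EuclideanSpace ℝ (Fin d) ≃ₗᵢ[ℝ] EuclideanSpace ℝ (Fin d)} (hT : ∀ x, T x = c • O x)
    (x : EuclideanSpace ℝ (Fin d)) : T.symm x = c⁻¹ • O.symm x := by
  apply T.injective
  rw [T.apply_symm_apply, hT, map_smul, O.apply_symm_apply, smul_smul, mul_inv_cancel₀ hc,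
    one_smul]

theorem plateSum_image_eq_of_similarity [Nonempty (Fin d)] (ho : IsOpen Ω) (hne : Ω.Nonempty) (hb : Bornology.IsBounded Ω)
    (T : EuclideanSpace ℝ (Fin d) ≃ₗ[ℝ] EuclideanSpace ℝ (Fin d)) (τ : ℝ) (n : ℕ)
    {c : ℝ} (hc : c ≠ 0)
    {O : EuclideanSpace ℝ (Fin d) ≃ₗᵢ[ℝ] EuclideanSpace ℝ (Fin d)} (hT : ∀ x, T x = c • O x) :
    plateSum (T '' Ω) (c⁻¹ ^ 2 * τ) n = (c⁻¹ ^ 2) ^ 2 * plateSum Ω τ n := by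
  have hS := symm_apply_of_similarity hc hT
  have hbT := isBounded_image_linearEquiv hb T
  apply le_antisymm
  · exact plateSum_similarity_le ho hne hb T.symm hbT (stdMatrix_mul_transpose_of_similarity hS) τ n
  · have himg : T.symm '' (T '' Ω) = Ω := by
      rw [← Set.image_comp]
      simp
    have h1 := plateSum_similarity_le (Ω := T '' Ω) (T.toContinuousLinearEquiv.toHomeomorph.isOpenMap _ ho)
      (hne.image T) hbT T (by rw [himg]; exact hb) (stdMatrix_mul_transpose_of_similarity hT)
      (c⁻¹ ^ 2 * τ) n
    have e1 : c ^ 2 * (c⁻¹ ^ 2 * τ) = τ := by field_simp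
    rw [himg, e1] at h1
    calc (c⁻¹ ^ 2) ^ 2 * plateSum Ω τ n
        ≤ (c⁻¹ ^ 2) ^ 2 * ((c ^ 2) ^ 2 * plateSum (T '' Ω) (c⁻¹ ^ 2 * τ) n) := by gcongr
      _ = plateSum (T '' Ω) (c⁻¹ ^ 2 * τ) n := by field_simp

theorem schattenPow_of_similarity {A : EuclideanSpace ℝ (Fin d) →ₗ[ℝ] EuclideanSpace ℝ (Fin d)}
    {r : ℝ} {O : EuclideanSpace ℝ (Fin d) ≃ₗᵢ[ℝ] EuclideanSpace ℝ (Fin d)}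
    (h : ∀ x, A x = r • O x) :
    schattenPow 2 A = r ^ 2 * d ∧ schattenPow 4 A = (r ^ 2) ^ 2 * d := by
  rw [schattenPow_two, schattenPow_four, stdMatrix_mul_transpose_of_similarity h]
  constructor
  · simp
  · simp [sq, mul_assoc]

end Main

end

theorem theorem1 {d : ℕ} (Ω : Set (EuclideanSpace ℝ (Fin d)))
    (hopen : IsOpen Ω) (hconn : IsConnected Ω) (hbdd : Bornology.IsBounded Ω)
    (hirr : (isometryRep Ω).IsIrreducible)
    (T : EuclideanSpace ℝ (Fin d) ≃ₗ[ℝ] EuclideanSpace ℝ (Fin d)) (τ : ℝ) (n : ℕ) :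
    plateSum (T '' Ω) (τ * constC T.symm.toLinearMap / schattenPow 2 T.symm.toLinearMap) n
        ≤ constC T.symm.toLinearMap / d * plateSum Ω τ n
    ∧ (AdmitsFrames 2 Ω →
      plateSum (T '' Ω) (τ * constD T.symm.toLinearMap / schattenPow 2 T.symm.toLinearMap) n
        ≤ constD T.symm.toLinearMap / d * plateSum Ω τ n)
    ∧ constD T.symm.toLinearMap ≤ constC T.symm.toLinearMap
    ∧ ((∃ (c : ℝ) (O : EuclideanSpace ℝ (Fin d) ≃ₗᵢ[ℝ] EuclideanSpace ℝ (Fin d)),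
          ∀ x, T x = c • O x) →
      plateSum (T '' Ω) (τ * constC T.symm.toLinearMap / schattenPow 2 T.symm.toLinearMap) n
        = constC T.symm.toLinearMap / d * plateSum Ω τ n
      ∧ plateSum (T '' Ω) (τ * constD T.symm.toLinearMap / schattenPow 2 T.symm.toLinearMap) n
        = constD T.symm.toLinearMap / d * plateSum Ω τ n) := by
  have hne := hconn.nonempty
  refine ⟨plateSum_image_le_constC hopen hne hbdd hirr T τ n,
    plateSum_image_le_constD hopen hne hbdd hirr T τ n, constD_le_constC _, ?_⟩
  rintro ⟨c, O, hT⟩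
  have := nonempty_of_isIrreducible hirr
  have hd : (d : ℝ) ≠ 0 := Nat.cast_ne_zero.2 (Fin.pos_iff_nonempty.2 this).ne'
  have hc : c ≠ 0 := by
    rintro rfl
    obtain ⟨x, hx⟩ := exists_ne (0 : EuclideanSpace ℝ (Fin d))
    exact hx (T.injective (by rw [hT, zero_smul, map_zero]))
  have hS : ∀ x, T.symm.toLinearMap x = c⁻¹ • O.symm x :=
    symm_apply_of_similarity hc hT
  obtain ⟨h2, h4⟩ := schattenPow_of_similarity hS
  have hsim := plateSum_image_eq_of_similarity hopen hne hbdd T τ n hc hT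
  have hd2 : (d : ℝ) + 2 ≠ 0 := by positivity
  have hC : constC T.symm.toLinearMap = (c⁻¹ ^ 2) ^ 2 * d := h4
  have hD : constD T.symm.toLinearMap = (c⁻¹ ^ 2) ^ 2 * d := by
    rw [constD, h2, h4]
    field_simp
  have e1 : τ * ((c⁻¹ ^ 2) ^ 2 * d) / (c⁻¹ ^ 2 * d) = c⁻¹ ^ 2 * τ := by field_simp
  have e2 : (c⁻¹ ^ 2) ^ 2 * d / d = (c⁻¹ ^ 2) ^ 2 := by field_simp
  rw [hC, hD, h2, e1, e2]
  exact ⟨hsim, hsim⟩
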